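/- Let $\Gamma$ be an alphabet of constant letters (any set), and let $X\notin\Gamma$ be a variable. A one-variable word equation with constants over $\Gamma$ is a pair $(U,V)$ of words $U,V\in(\{X\}\cup\Gamma)^*$. Its solutions are the monoid morphisms $h:(\{X\}\cup\Gamma)^*\to\Gamma^*$ with $h(c)=c$ for all $c\in\Gamma$ and $h(U)=h(V)$. (i) If a one-variable word equation over $\Gamma$ has only finitely many solutions, then it has at most three solutions. (ii) The bound three is optimal: if $\Gamma$ has at least two letters, then there is a one-variable word equation over $\Gamma$ that has exactly three solutions. -/

import Mathlib

/-- A word equation with constants, with variables in `Ξ` and constant letters in `Γ`: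
a pair of words over the disjoint union of the two alphabets. -/
structure WordEquation (Ξ Γ : Type*) where
  lhs : FreeMonoid (Ξ ⊕ Γ)
  rhs : FreeMonoid (Ξ ⊕ Γ)

namespace WordEquation

/-- The set of solutions of a word equation: the constant-preserving morphisms from words over
variables and constants to words over constants that identify the two sides. -/
def sol {Ξ Γ : Type*} (E : WordEquation Ξ Γ) :
    Set (FreeMonoid (Ξ ⊕ Γ) →* FreeMonoid Γ) :=
  {h | (∀ c : Γ, h (FreeMonoid.of (Sum.inr c)) = FreeMonoid.of c) ∧ h E.lhs = h E.rhs}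

end WordEquation

-- A constant-preserving morphism is determined by the value t of X, so solutions are words. Those
-- of a nontrivial equation form a prefix chain; if there are four, replacing X by t₀X, with t₀ the
-- shortest, makes them the empty word and x, y, z of increasing lengths. Infinitely many solutions
-- must then exist. They always come from `pw_solutions`: two solutions ρ^a r and ρ^b r with 1 ≤ a <
-- b force all ρ^n r to be solutions.
--
-- To learn about x, y, z, take a shortest nontrivial equation solved by the four words
-- (`exists_balanced`): at every proper cut V has more variables than U. Either overlaps exhibit two
-- of the words as ρ^a r and ρ^b r, or |y| ≥ 2|x|, U starts with at least |y| constants and V ends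
-- with as many. In the latter case truncation (`Balanced.lsys`) from either end gives an `LSys`,
-- where the variables of V run well ahead of those of U.
--
-- For such systems, assign integer weights to letters and read prefix weights as heights. The first
-- prefix that reaches an extremal height is common to both sides; comparing two substitutions of
-- different lengths equates the counts of variables and constants there, which the interleaving
-- forbids in most cases. With a system from each end, a weight taking equal values on x, y, z is
-- zero on them, and so is every block of constants between variables (`weight_eq_zero`, `flat`). A
-- first-moment identity (`LSys.area`) supplies such a weight, nonzero on some letter of z, unless z
-- uses a single letter. Minimal factors of weight zero then serve as letters of a shorter system,
-- and induction (`LSys.exists_pw`) makes y and z powers of one word.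
--
-- Optimality is an explicit equation, checked by a length bound and a finite search.

universe u

namespace OneVar

open List

/-! ### Powers, primitive words and prefixes of periodic words -/

section Words

variable {α : Type u}

/-- The `n`-fold power of a word. -/
def pw (r : List α) (n : ℕ) : List α := (replicate n r).flatten

@[simp] lemma pw_zero (r : List α) : pw r 0 = [] := rfl

lemma pw_succ (r : List α) (n : ℕ) : pw r (n + 1) = r ++ pw r n := by
  simp [pw, replicate_succ]

@[simp] lemma pw_one (r : List α) : pw r 1 = r := by simp [pw]

lemma pw_add (r : List α) (m n : ℕ) : pw r (m + n) = pw r m ++ pw r n := by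
  induction m with
  | zero => simp
  | succ m ih => rw [Nat.add_right_comm, pw_succ, ih, pw_succ, append_assoc]

lemma pw_succ' (r : List α) (n : ℕ) : pw r (n + 1) = pw r n ++ r := by
  rw [pw_add, pw_one]

lemma pw_mul (r : List α) (m n : ℕ) : pw r (m * n) = pw (pw r m) n := by
  induction n with
  | zero => simp
  | succ n ih => rw [Nat.mul_succ, Nat.add_comm, pw_add, ih, pw_succ]

@[simp] lemma length_pw (r : List α) (n : ℕ) : (pw r n).length = n * r.length := by
  simp [pw]

lemma pw_comm (r : List α) (m n : ℕ) : pw r m ++ pw r n = pw r n ++ pw r m := by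
  rw [← pw_add, ← pw_add, Nat.add_comm]

lemma flatten_pw (r : List (List α)) (n : ℕ) : (pw r n).flatten = pw r.flatten n := by
  induction n with
  | zero => simp
  | succ n ih => rw [pw_succ, pw_succ, flatten_append, ih]

/-- Euclid's algorithm: the shorter word is a prefix of the longer, and the remainder still commutes
with it. -/
lemma exists_pw_of_commute : ∀ (n : ℕ) (u v : List α), u.length + v.length ≤ n →
    u ++ v = v ++ u → ∃ (r : List α) (i j : ℕ), u = pw r i ∧ v = pw r j := by
  intro n
  induction n with
  | zero =>
    intro u v h _
    refine ⟨[], 0, 0, ?_, ?_⟩ <;> (apply eq_nil_of_length_eq_zero; omega)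
  | succ n ih =>
    intro u v h huv
    rcases eq_or_ne u [] with rfl | hu
    · exact ⟨v, 0, 1, by simp, by simp⟩
    rcases eq_or_ne v [] with rfl | hv
    · exact ⟨u, 1, 0, by simp, by simp⟩
    have hu' := length_pos_iff.2 hu
    have hv' := length_pos_iff.2 hv
    rcases prefix_or_prefix_of_prefix (prefix_append u v) (huv ▸ prefix_append v u) with h1 | h1
    · obtain ⟨w, rfl⟩ := h1
      have h2 : u ++ w = w ++ u := by simpa using huv
      obtain ⟨r, i, j, hi, hj⟩ := ih u w (by simp at h; omega) h2
      exact ⟨r, i, i + j, hi, by rw [pw_add, ← hi, ← hj]⟩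
    · obtain ⟨w, rfl⟩ := h1
      have h2 : w ++ v = v ++ w := by simpa using huv
      obtain ⟨r, i, j, hi, hj⟩ := ih w v (by simp at h; omega) h2
      exact ⟨r, j + i, j, by rw [pw_add, ← hi, ← hj], hj⟩

/-- A nonempty word that is not a product of two commuting nonempty words. -/
def Prim (r : List α) : Prop := r ≠ [] ∧ ∀ u v, r = u ++ v → u ++ v = v ++ u → u = [] ∨ v = []

lemma exists_prim_root : ∀ (n : ℕ) (r : List α), r.length ≤ n → r ≠ [] →
    ∃ (s : List α) (d : ℕ), Prim s ∧ 1 ≤ d ∧ r = pw s d := by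
  intro n
  induction n with
  | zero => intro r h h'; exact absurd (eq_nil_of_length_eq_zero (by omega)) h'
  | succ n ih =>
    intro r h hr
    by_cases hp : Prim r
    · exact ⟨r, 1, hp, le_rfl, by simp⟩
    · simp only [Prim, not_and, not_forall] at hp
      obtain ⟨u, v, h1, h2, h3⟩ := hp hr
      push Not at h3
      obtain ⟨s, i, j, hi, hj⟩ := exists_pw_of_commute _ u v le_rfl h2
      have hs : r = pw s (i + j) := by rw [pw_add, ← hi, ← hj, h1]
      have hi0 : i ≠ 0 := by rintro rfl; exact h3.1 hi
      have hj0 : j ≠ 0 := by rintro rfl; exact h3.2 hj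
      have hs0 : s ≠ [] := by rintro rfl; apply hr; rw [hs]; simp [pw]
      have hl : s.length < r.length := by
        rw [hs, length_pw]; have := length_pos_iff.2 hs0; nlinarith [Nat.pos_of_ne_zero hi0, Nat.pos_of_ne_zero hj0]
      obtain ⟨s', d, hp', hd, he⟩ := ih s (by omega) hs0
      exact ⟨s', d * (i + j), hp', Nat.mul_pos hd (by omega), by rw [pw_mul, ← he, hs]⟩

/-- Being a prefix of some power of `r`. -/
def Pf (r t : List α) : Prop := ∃ n, t <+: pw r n

lemma Pf.mono {r s t : List α} (h : Pf r t) (hst : s <+: t) : Pf r s :=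
  let ⟨n, hn⟩ := h; ⟨n, hst.trans hn⟩

lemma pf_nil (r : List α) : Pf r [] := ⟨0, nil_prefix⟩

lemma pf_pw_append {r t : List α} (n : ℕ) : Pf r (pw r n ++ t) ↔ Pf r t := by
  constructor
  · rintro ⟨m, hm⟩
    rcases le_total n m with h | h
    · obtain ⟨k, rfl⟩ := Nat.exists_eq_add_of_le h
      rw [pw_add, prefix_append_right_inj] at hm
      exact ⟨k, hm⟩
    · have h1 : (pw r n ++ t) <+: pw r n ++ [] := by
        obtain ⟨k, rfl⟩ := Nat.exists_eq_add_of_le h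
        rw [append_nil]
        exact hm.trans (by rw [pw_add]; exact prefix_append _ _)
      rw [prefix_append_right_inj, prefix_nil] at h1
      rw [h1]; exact pf_nil r
  · rintro ⟨m, hm⟩
    exact ⟨n + m, by rw [pw_add, prefix_append_right_inj]; exact hm⟩

/-- A power of a primitive word is recognized by an occurrence of that word right after it. -/
lemma Prim.eq_pw_of_pf {r : List α} (hr : Prim r) : ∀ (n : ℕ) (v : List α), v.length ≤ n →
    Pf r (v ++ r) → ∃ e, v = pw r e := by
  intro n
  induction n with
  | zero => intro v hv _; exact ⟨0, eq_nil_of_length_eq_zero (by omega)⟩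
  | succ n ih =>
    intro v hv h
    have hr0 := length_pos_iff.2 hr.1
    obtain ⟨m, hm⟩ := h
    rcases le_or_gt r.length v.length with h1 | h1
    · have hm0 : m ≠ 0 := by
        rintro rfl
        have := hm.length_le
        simp at this
        exact hr.1 this.2
      obtain ⟨m, rfl⟩ := Nat.exists_eq_succ_of_ne_zero hm0
      rw [Nat.succ_eq_add_one, pw_succ] at hm
      have h2 : r <+: v :=
        prefix_of_prefix_length_le (prefix_append r _) ((prefix_append v r).trans hm) h1
      obtain ⟨v', rfl⟩ := h2
      rw [append_assoc, prefix_append_right_inj] at hm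
      obtain ⟨e, he⟩ := ih v' (by simp at hv; omega) ⟨m, hm⟩
      exact ⟨e + 1, by rw [pw_succ, ← he]⟩
    -- Now v is shorter than r, so v r is a prefix of r r; with r = v w this yields v w = w v, and
    -- primitivity applies.
    · have hp : Pf r (v ++ r) := ⟨m, hm⟩
      have h3 : v ++ r <+: r ++ r ++ pw r m := by
        have : pw r m <+: r ++ r ++ pw r m := by
          refine ⟨r ++ r, ?_⟩
          have := pw_comm r m 2
          simpa [pw] using this
        exact hm.trans this
      have h4 : v ++ r <+: r ++ r :=
        prefix_of_prefix_length_le h3 (prefix_append _ _) (by simp; omega)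
      have h5 : v <+: r :=
        prefix_of_prefix_length_le ((prefix_append v r).trans h4) (prefix_append _ _) h1.le
      obtain ⟨w, hw⟩ := h5
      have h6 : v ++ (v ++ w) <+: v ++ (w ++ (v ++ w)) := by
        rw [hw]; rw [← append_assoc v w r, hw]; exact h4
      rw [prefix_append_right_inj] at h6
      have h7 : v ++ w = w ++ v := by
        have : v ++ w <+: (w ++ v) ++ w := by simpa using h6
        exact (prefix_of_prefix_length_le this (prefix_append _ _) (by simp; omega)).eq_of_length
          (by simp; omega)
      rcases hr.2 v w hw.symm h7 with rfl | rfl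
      · exact ⟨0, rfl⟩
      · exact ⟨1, by simpa using hw⟩

/-- Locates the departure of a word from r r r …; by `first_not_pf_unique` this position can be
computed from either side of an equation. -/
lemma exists_first_not_pf {r : List α} : ∀ (g : List α), ¬ Pf r g →
    ∃ g0 c, g0 ++ [c] <+: g ∧ Pf r g0 ∧ ¬ Pf r (g0 ++ [c]) := by
  intro g
  induction g using List.reverseRecOn with
  | nil => intro h; exact absurd (pf_nil r) h
  | append_singleton g c ih =>
    intro h
    by_cases hg : Pf r g
    · exact ⟨g, c, prefix_rfl, hg, h⟩
    · obtain ⟨g0, d, h1, h2, h3⟩ := ih hg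
      exact ⟨g0, d, h1.trans (prefix_append _ _), h2, h3⟩

lemma first_not_pf_unique {r T g h : List α} {c d : α} (hg : Pf r g) (hgc : ¬ Pf r (g ++ [c]))
    (hh : Pf r h) (hhd : ¬ Pf r (h ++ [d])) (h1 : g ++ [c] <+: T) (h2 : h ++ [d] <+: T) :
    g.length = h.length := by
  by_contra hne
  rcases lt_or_gt_of_ne hne with hlt | hlt
  · exact hgc (hh.mono (prefix_of_prefix_length_le h1 ((prefix_append h [d]).trans h2)
      (by simp; omega)))
  · exact hhd (hg.mono (prefix_of_prefix_length_le h2 ((prefix_append g [c]).trans h1)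
      (by simp; omega)))

end Words

/-! ### Substitution into a side and symbol counts -/

section Substitution

variable {α : Type u}

/-- Substitution of the word `t` for the variable `none` in a side of an equation. -/
def sub (t : List α) : List (Option α) → List α
  | [] => []
  | none :: W => t ++ sub t W
  | some c :: W => c :: sub t W

/-- The number of occurrences of the variable. -/
def cX : List (Option α) → ℕ
  | [] => 0
  | none :: W => cX W + 1
  | some _ :: W => cX W

@[simp] lemma sub_nil (t : List α) : sub t [] = [] := rfl
@[simp] lemma sub_none (t : List α) (W) : sub t (none :: W) = t ++ sub t W := rfl
@[simp] lemma sub_some (t : List α) (c W) : sub t (some c :: W) = c :: sub t W := rfl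
@[simp] lemma cX_nil : cX ([] : List (Option α)) = 0 := rfl
@[simp] lemma cX_none (W : List (Option α)) : cX (none :: W) = cX W + 1 := rfl
@[simp] lemma cX_some (c : α) (W) : cX (some c :: W) = cX W := rfl

/-- Induction on equation sides, one symbol at a time. -/
@[elab_as_elim]
lemma side_induction {P : List (Option α) → Prop} (W : List (Option α)) (nil : P [])
    (none : ∀ W, P W → P (none :: W)) (some : ∀ c W, P W → P (some c :: W)) : P W := by
  induction W with
  | nil => exact nil
  | cons o W ih => cases o; exacts [none W ih, some _ W ih]

@[simp] lemma sub_append (t : List α) (A B) : sub t (A ++ B) = sub t A ++ sub t B := by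
  induction A using side_induction <;> simp_all

@[simp] lemma cX_append (A B : List (Option α)) : cX (A ++ B) = cX A + cX B := by
  induction A using side_induction <;> (simp_all; try omega)

@[simp] lemma sub_map_some (t v : List α) : sub t (v.map some) = v := by
  induction v <;> simp_all

@[simp] lemma cX_map_some (v : List α) : cX (v.map some) = 0 := by
  induction v <;> simp_all

lemma length_sub (t : List α) (W) :
    (sub t W).length = (sub [] W).length + cX W * t.length := by
  induction W using side_induction with
  | nil => simp
  | none W ih => simp [ih]; ring
  | some c W ih => simp [ih]; ring

lemma length_side (W : List (Option α)) : W.length = (sub [] W).length + cX W := by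
  induction W using side_induction with
  | nil => simp
  | none W ih => simp [ih]; ring
  | some c W ih => simp [ih]; ring

lemma sub_prefix (t : List α) {A B} (h : A <+: B) : sub t A <+: sub t B := by
  obtain ⟨C, rfl⟩ := h; simp

lemma sub_reverse (t : List α) (W) : sub t.reverse W.reverse = (sub t W).reverse := by
  induction W using side_induction <;> simp_all

lemma cX_reverse (W : List (Option α)) : cX W.reverse = cX W := by
  induction W using side_induction <;> simp_all

lemma eq_map_of_cX_eq_zero {W : List (Option α)} (h : cX W = 0) : W = (sub [] W).map some := by
  induction W using side_induction with
  | nil => rfl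
  | none W ih => simp at h
  | some c W ih => rw [sub_some, map_cons, ← ih h]

/-- Equal total lengths after two substitutions of different lengths force equal numbers of
variables and of constants. -/
lemma counts_of_length {A B : List (Option α)} {s t : List α} (hst : s.length < t.length)
    (h1 : (sub s A).length = (sub s B).length) (h2 : (sub t A).length = (sub t B).length) :
    cX A = cX B ∧ (sub [] A).length = (sub [] B).length := by
  rw [length_sub, length_sub _ B] at h1 h2
  obtain ⟨d, hd⟩ := Nat.exists_eq_add_of_lt hst
  rw [hd] at h2
  have h3 : cX A * (d + 1) = cX B * (d + 1) := by
    have e1 : cX A * (s.length + d + 1) = cX A * s.length + cX A * (d + 1) := by ring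
    have e2 : cX B * (s.length + d + 1) = cX B * s.length + cX B * (d + 1) := by ring
    omega
  have h4 : cX A = cX B := Nat.eq_of_mul_eq_mul_right (Nat.succ_pos d) h3
  refine ⟨h4, ?_⟩
  rw [h4] at h1; omega

end Substitution

/-! ### Two solutions in a periodic family give the whole family -/

section PowerSolutions

variable {α : Type u}

/-- A side without a factor consisting of `r` followed by the variable. -/
def Irr (r : List α) (W : List (Option α)) : Prop :=
  ∀ A B, W ≠ A ++ r.map some ++ none :: B

/-- The sum, over the occurrences of the variable, of the number of preceding constants. -/
def gam : List (Option α) → ℕ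
  | [] => 0
  | none :: W => gam W
  | some _ :: W => gam W + cX W

lemma gam_append (A B : List (Option α)) :
    gam (A ++ B) = gam A + gam B + (sub [] A).length * cX B := by
  induction A using side_induction with
  | nil => simp [gam]
  | none W ih => simp [gam, ih]
  | some c W ih => simp [gam, ih]; ring

lemma gam_map_some (v : List α) : gam (v.map some) = 0 := by
  induction v <;> simp_all [gam]

/-- Powers of r commute with r, so rewriting r X to X r preserves all these values; each rewriting
lowers `gam`. -/
lemma exists_irr {r : List α} (hr : r ≠ []) : ∀ (k : ℕ) (W : List (Option α)), gam W ≤ k →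
    ∃ W', Irr r W' ∧ ∀ n, sub (pw r n) W' = sub (pw r n) W := by
  intro k
  induction k with
  | zero =>
    intro W hW
    refine ⟨W, ?_, fun _ => rfl⟩
    rintro A B rfl
    have := length_pos_iff.2 hr
    simp only [gam_append, gam_map_some, gam, cX_none, sub_append, sub_map_some, length_append,
      cX_map_some] at hW
    nlinarith [hW, Nat.zero_le ((sub [] A).length * (cX B + 1))]
  | succ k ih =>
    intro W hW
    by_cases h : Irr r W
    · exact ⟨W, h, fun _ => rfl⟩
    simp only [Irr, not_forall, not_not] at h
    obtain ⟨A, B, rfl⟩ := h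
    have hr' := length_pos_iff.2 hr
    obtain ⟨W', h1, h2⟩ := ih (A ++ none :: r.map some ++ B) (by
      simp only [gam_append, gam_map_some, gam, cX_none, sub_append, sub_map_some, length_append,
        cX_map_some, sub_none, nil_append] at hW ⊢
      nlinarith [hW, hr'])
    refine ⟨W', h1, fun n => ?_⟩
    rw [h2]
    have : pw r n ++ r = r ++ pw r n := by rw [← pw_succ, pw_succ']
    simp only [sub_append, sub_none, sub_map_some, append_assoc]
    rw [← append_assoc (pw r n), this, append_assoc]

lemma Irr.tail {r : List α} {A B : List (Option α)} (h : Irr r (A ++ B)) : Irr r B := by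
  rintro C D rfl
  exact h (A ++ C) D (by simp)

lemma exists_leading_letters (W : List (Option α)) :
    ∃ v : List α, W = v.map some ∨ ∃ W', W = v.map some ++ none :: W' := by
  induction W using side_induction with
  | nil => exact ⟨[], Or.inl rfl⟩
  | none W ih => exact ⟨[], Or.inr ⟨W, rfl⟩⟩
  | some c W ih =>
    obtain ⟨v, h | ⟨W', h⟩⟩ := ih
    · exact ⟨c :: v, Or.inl (by simp [h])⟩
    · exact ⟨c :: v, Or.inr ⟨W', by simp [h]⟩⟩

lemma exists_leading_vars (W : List (Option α)) :
    ∃ k W', W = replicate k none ++ W' ∧ ∀ W'', W' ≠ none :: W'' := by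
  induction W using side_induction with
  | nil => exact ⟨0, [], rfl, by simp⟩
  | none W ih =>
    obtain ⟨k, W', h, h'⟩ := ih
    exact ⟨k + 1, W', by simp [h, replicate_succ], h'⟩
  | some c W ih => exact ⟨0, some c :: W, rfl, by simp⟩

lemma sub_replicate_none (r : List α) (n k : ℕ) :
    sub (pw r n) (replicate k none) = pw r (n * k) := by
  induction k with
  | zero => simp
  | succ k ih => rw [replicate_succ, sub_none, ih, ← pw_add]; congr 1; ring

/-- If the leading block v follows r r r … and a variable comes next, the value starts with v r.
Were that still periodic, v would be a power of r, which irreducibility excludes. Since n ≥ 1, the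
departure from the period does not depend on n. -/
lemma Irr.start {r : List α} (hr : Prim r) {W : List (Option α)} (hW : Irr r W)
    (hn : ∀ W', W ≠ none :: W') :
    (∃ v, W = v.map some ∧ Pf r v) ∨
      ∃ g, ¬ Pf r g ∧ ∀ n, 1 ≤ n → g <+: sub (pw r n) W := by
  obtain ⟨v, h⟩ := exists_leading_letters W
  by_cases hv : Pf r v
  · rcases h with rfl | ⟨W', rfl⟩
    · exact Or.inl ⟨v, rfl, hv⟩
    · refine Or.inr ⟨v ++ r, ?_, ?_⟩
      · intro hp
        obtain ⟨e, rfl⟩ := hr.eq_pw_of_pf _ v le_rfl hp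
        cases e with
        | zero => exact hn W' (by simp)
        | succ e => exact hW ((pw r e).map some) W' (by simp [pw_succ'])
      · intro n hn'
        obtain ⟨m, rfl⟩ := Nat.exists_eq_add_of_le' hn'
        simp [pw_succ]
  · refine Or.inr ⟨v, hv, fun n _ => ?_⟩
    rcases h with rfl | ⟨W', rfl⟩ <;> simp

/-- With k + 1 leading variables on the left, the left value leaves r r r … at a position growing
with the exponent, the right value at a fixed one. Both cannot agree for two exponents. -/
lemma irr_head_absurd {r : List α} (hr : Prim r) {a b : ℕ} (ha : 1 ≤ a) (hab : a < b)
    {U V : List (Option α)} (hU : Irr r (none :: U)) (hV : Irr r V) (hn : ∀ V', V ≠ none :: V')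
    (h1 : sub (pw r a) (none :: U) = sub (pw r a) V)
    (h2 : sub (pw r b) (none :: U) = sub (pw r b) V) : False := by
  have hr0 := length_pos_iff.2 hr.1
  obtain ⟨k, U', hk, hU'⟩ := exists_leading_vars U
  have hI : Irr r U' := by
    have : none :: U = (none :: replicate k none) ++ U' := by rw [hk]; rfl
    rw [this] at hU; exact hU.tail
  have he : ∀ n, sub (pw r n) (none :: U) = pw r (n * (k + 1)) ++ sub (pw r n) U' := by
    intro n
    rw [hk, ← sub_replicate_none, replicate_succ]
    simp only [sub_none, sub_append, append_assoc]
  rw [he] at h1 h2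
  rcases hV.start hr hn with ⟨v, rfl, hv⟩ | ⟨g, hg, hgp⟩
  · rw [sub_map_some] at h1 h2
    have := congrArg length (h1.trans h2.symm)
    rw [length_append, length_append, length_sub (pw r a), length_sub (pw r b)] at this
    simp only [length_pw] at this
    have h3 : a * (k + 1) * r.length < b * (k + 1) * r.length := by
      apply Nat.mul_lt_mul_of_pos_right _ hr0
      exact Nat.mul_lt_mul_of_pos_right hab (Nat.succ_pos k)
    have h4 : cX U' * (a * r.length) ≤ cX U' * (b * r.length) := by gcongr
    omega
  · obtain ⟨g0, c, hg1, hg2, hg3⟩ := exists_first_not_pf g hg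
    rcases hI.start hr hU' with ⟨v, rfl, hv⟩ | ⟨h, hh, hhp⟩
    · rw [sub_map_some] at h1
      exact hg (((pf_pw_append _).2 hv).mono (h1 ▸ hgp a ha))
    · obtain ⟨h0, d, hh1, hh2, hh3⟩ := exists_first_not_pf h hh
      have key : ∀ n, 1 ≤ n →
          pw r (n * (k + 1)) ++ sub (pw r n) U' = sub (pw r n) V →
          g0.length = n * (k + 1) * r.length + h0.length := by
        intro n hn1 heq
        have := first_not_pf_unique (h := pw r (n * (k + 1)) ++ h0) (d := d) hg2 hg3
          ((pf_pw_append _).2 hh2) (by rw [append_assoc, pf_pw_append]; exact hh3)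
          (hg1.trans (hgp n hn1)) (by
            rw [← heq, append_assoc, prefix_append_right_inj]
            exact hh1.trans (hhp n hn1))
        simpa using this
      have h3 : a * (k + 1) * r.length < b * (k + 1) * r.length := by
        apply Nat.mul_lt_mul_of_pos_right _ hr0
        exact Nat.mul_lt_mul_of_pos_right hab (Nat.succ_pos k)
      have := key a ha h1
      have := key b (by omega) h2
      omega

lemma irr_eq {r : List α} (hr : Prim r) {a b : ℕ} (ha : 1 ≤ a) (hab : a < b) :
    ∀ (U V : List (Option α)), Irr r U → Irr r V → sub (pw r a) U = sub (pw r a) V →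
      sub (pw r b) U = sub (pw r b) V → U = V := by
  intro U
  induction U using side_induction with
  | nil =>
    intro V hU hV h1 h2
    match V with
    | [] => rfl
    | none :: V => exact (irr_head_absurd hr ha hab hV hU (by simp) h1.symm h2.symm).elim
    | some c :: V => simp at h1
  | none U ih =>
    intro V hU hV h1 h2
    match V with
    | [] => exact (irr_head_absurd hr ha hab hU hV (by simp) h1 h2).elim
    | none :: V =>
      simp only [sub_none, append_cancel_left_eq] at h1 h2
      rw [ih V (Irr.tail (A := [none]) hU) (Irr.tail (A := [none]) hV) h1 h2]
    | some c :: V => exact (irr_head_absurd hr ha hab hU hV (by simp) h1 h2).elim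
  | some c U ih =>
    intro V hU hV h1 h2
    match V with
    | [] => simp at h1
    | none :: V => exact (irr_head_absurd hr ha hab hV hU (by simp) h1.symm h2.symm).elim
    | some d :: V =>
      simp only [sub_some, cons.injEq] at h1 h2
      rw [ih V (Irr.tail (A := [some c]) hU) (Irr.tail (A := [some d]) hV) h1.2 h2.2, h1.1]

/-- Replacing the variable `X` by `X r`. -/
def mulRight (r : List α) : List (Option α) → List (Option α)
  | [] => []
  | none :: W => none :: (r.map some ++ mulRight r W)
  | some c :: W => some c :: mulRight r W

lemma sub_mulRight (r t : List α) (W) : sub t (mulRight r W) = sub (t ++ r) W := by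
  induction W using side_induction <;> simp_all [mulRight]

/-- Two solutions `ρ ^ a * r` and `ρ ^ b * r` with `1 ≤ a < b` generate a whole family. -/
theorem pw_solutions {ρ r : List α} (hρ : ρ ≠ []) {a b : ℕ} (ha : 1 ≤ a) (hab : a < b)
    {U V : List (Option α)} (h1 : sub (pw ρ a ++ r) U = sub (pw ρ a ++ r) V)
    (h2 : sub (pw ρ b ++ r) U = sub (pw ρ b ++ r) V) (n : ℕ) :
    sub (pw ρ n ++ r) U = sub (pw ρ n ++ r) V := by
  obtain ⟨s, d, hs, hd, rfl⟩ := exists_prim_root _ ρ le_rfl hρ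
  -- Passing to the primitive root s of ρ and writing X r for X turns both solutions into pure
  -- powers of s.
  simp only [← sub_mulRight, ← pw_mul] at h1 h2 ⊢
  obtain ⟨U', hU, hU'⟩ := exists_irr hs.1 _ (mulRight r U) le_rfl
  obtain ⟨V', hV, hV'⟩ := exists_irr hs.1 _ (mulRight r V) le_rfl
  have := irr_eq hs (a := d * a) (b := d * b) (Nat.mul_pos hd ha)
    (Nat.mul_lt_mul_of_pos_left hab hd) U' V' hU hV (by rw [hU', hV', h1]) (by rw [hU', hV', h2])
  rw [← hU', ← hV', this]

end PowerSolutions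

/-! ### Occurrences of symbols and prefixes of values -/

section Occurrences

variable {α : Type u}

/-- `At W A o`: the symbol `o` occurs in `W` right after the prefix `A`. -/
def At (W A : List (Option α)) (o : Option α) : Prop := A ++ [o] <+: W

/-- The number of constants in a side. -/
abbrev cC (W : List (Option α)) : ℕ := (sub [] W).length

lemma At.pre {W A : List (Option α)} {o} (h : At W A o) : A <+: W :=
  (prefix_append A [o]).trans h

lemma At.mono {W W' A : List (Option α)} {o} (h : At W A o) (hW : W <+: W') : At W' A o :=
  h.trans hW

lemma At.of_lt {W A B : List (Option α)} {o} (h : At W A o) (hB : B <+: W)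
    (hl : A.length < B.length) : At B A o :=
  prefix_of_prefix_length_le h hB (by simp; omega)

lemma At.trichotomy {W A B : List (Option α)} {o o'} (hA : At W A o) (hB : At W B o') :
    (A = B ∧ o = o') ∨ At B A o ∨ At A B o' := by
  rcases lt_trichotomy A.length B.length with h | h | h
  · exact Or.inr (Or.inl (hA.of_lt hB.pre h))
  · left
    have : A ++ [o] = B ++ [o'] :=
      (prefix_of_prefix_length_le hA hB (by simp [h])).eq_of_length (by simp [h])
    simpa using append_inj this h
  · exact Or.inr (Or.inr (hB.of_lt hA.pre h))

lemma cX_mono {A B : List (Option α)} (h : A <+: B) : cX A ≤ cX B := by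
  obtain ⟨C, rfl⟩ := h; simp

lemma cC_mono {A B : List (Option α)} (h : A <+: B) : cC A ≤ cC B :=
  (sub_prefix [] h).length_le

lemma At.cX_lt {W A : List (Option α)} (h : At W A none) : cX A < cX W := by
  have := cX_mono h; simp at this; omega

lemma At.cC_lt {W A : List (Option α)} {c} (h : At W A (some c)) : cC A < cC W := by
  have := cC_mono h; simp [cC] at this; simp [cC]; omega

lemma At.cons {W A : List (Option α)} {o} (h : At W A o) (o') : At (o' :: W) (o' :: A) o := by
  simpa [At] using h

lemma at_nil (W : List (Option α)) (o) : At (o :: W) [] o := by simp [At]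

lemma exists_at_none {W : List (Option α)} : ∀ {j : ℕ}, j < cX W →
    ∃ A, At W A none ∧ cX A = j := by
  induction W using side_induction with
  | nil => intro j hj; simp at hj
  | none W ih =>
    intro j hj
    cases j with
    | zero => exact ⟨[], at_nil _ _, rfl⟩
    | succ j =>
      obtain ⟨A, hA, h⟩ := ih (j := j) (by simpa using hj)
      exact ⟨none :: A, hA.cons _, by simp [h]⟩
  | some c W ih =>
    intro j hj
    obtain ⟨A, hA, h⟩ := ih (j := j) (by simpa using hj)
    exact ⟨some c :: A, hA.cons _, by simp [h]⟩

lemma exists_at_some {W : List (Option α)} : ∀ {k : ℕ}, k < cC W →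
    ∃ A c, At W A (some c) ∧ cC A = k := by
  induction W using side_induction with
  | nil => intro j hj; simp [cC] at hj
  | none W ih =>
    intro j hj
    obtain ⟨A, c, hA, h⟩ := ih (k := j) (by simpa [cC] using hj)
    exact ⟨none :: A, c, hA.cons _, by simpa [cC] using h⟩
  | some c W ih =>
    intro j hj
    cases j with
    | zero => exact ⟨[], c, at_nil _ _, rfl⟩
    | succ j =>
      obtain ⟨A, d, hA, h⟩ := ih (k := j) (by simpa [cC] using hj)
      exact ⟨some c :: A, d, hA.cons _, by simpa [cC] using h⟩

lemma At.none_of_append_map {A B : List (Option α)} {v : List α}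
    (h : At (A ++ v.map some) B none) : At A B none := by
  refine h.of_lt (prefix_append _ _) ?_
  by_contra hl
  obtain ⟨C, rfl⟩ : A <+: B := prefix_of_prefix_length_le (prefix_append _ _) h.pre (by omega)
  have h1 : C ++ [none] <+: v.map some := by
    simpa [At, append_assoc, prefix_append_right_inj] using h
  have h2 := cX_mono h1
  simp at h2

/-- A nonempty prefix of a substituted side ends either at a constant or inside a variable. -/
lemma prefix_sub_cases (t : List α) {W : List (Option α)} : ∀ {p : List α}, p ≠ [] →
    p <+: sub t W → (∃ A c, At W A (some c) ∧ p = sub t A ++ [c]) ∨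
      ∃ A q, At W A none ∧ q ≠ [] ∧ q <+: t ∧ p = sub t A ++ q := by
  induction W using side_induction with
  | nil => intro p hp h; exact absurd (prefix_nil.1 h) hp
  | none W ih =>
    intro p hp h
    rcases le_or_gt p.length t.length with hl | hl
    · exact Or.inr ⟨[], p, at_nil _ _, hp,
        prefix_of_prefix_length_le h (prefix_append _ _) hl, by simp⟩
    · obtain ⟨p', rfl⟩ := prefix_of_prefix_length_le (prefix_append t (sub t W)) h hl.le
      have hp' : p' ≠ [] := by rintro rfl; simp at hl
      rcases ih hp' (by simpa using h) with ⟨A, c, hA, rfl⟩ | ⟨A, q, hA, h1, h2, rfl⟩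
      · exact Or.inl ⟨none :: A, c, hA.cons _, by simp⟩
      · exact Or.inr ⟨none :: A, q, hA.cons _, h1, h2, by simp⟩
  | some d W ih =>
    intro p hp h
    obtain ⟨e, p', rfl⟩ := exists_cons_of_ne_nil hp
    obtain ⟨rfl, h'⟩ := cons_prefix_cons.1 h
    rcases eq_or_ne p' [] with rfl | hp'
    · exact Or.inl ⟨[], e, at_nil _ _, by simp⟩
    · rcases ih hp' h' with ⟨A, c, hA, rfl⟩ | ⟨A, q, hA, h1, h2, rfl⟩
      · exact Or.inl ⟨some e :: A, c, hA.cons _, by simp⟩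
      · exact Or.inr ⟨some e :: A, q, hA.cons _, h1, h2, by simp⟩

lemma At.sub_some {W A : List (Option α)} {c} (h : At W A (some c)) (t : List α) :
    sub t A ++ [c] <+: sub t W := by
  simpa using sub_prefix t h

lemma At.sub_none {W A : List (Option α)} (h : At W A none) {t q : List α} (hq : q <+: t) :
    sub t A ++ q <+: sub t W := by
  have h1 : sub t A ++ t <+: sub t W := by simpa using sub_prefix t h
  exact ((prefix_append_right_inj _).2 hq).trans h1

lemma exists_shortest {β : Type*} {P : List β → Prop} (h : ∃ l, P l) :
    ∃ l, P l ∧ ∀ l', P l' → l.length ≤ l'.length := by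
  classical
  have h' : ∃ n, ∃ l, P l ∧ l.length = n := let ⟨l, hl⟩ := h; ⟨_, l, hl, rfl⟩
  obtain ⟨l, h1, h2⟩ := Nat.find_spec h'
  exact ⟨l, h1, fun l' hl' => h2 ▸ Nat.find_min' h' ⟨l', hl', rfl⟩⟩

lemma finite_prefixes {β : Type*} (l : List β) : {p | p <+: l}.Finite := by
  simpa only [← mem_inits] using List.finite_toSet l.inits

end Occurrences

/-! ### Interleaving of variables and constants in a system -/

section Systems

variable {α : Type u}

/-- A pair of sides, solved by three words that form a prefix chain, in which the occurrences of
the variable on the two sides are interleaved in a controlled way. -/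
structure LSys (U V : List (Option α)) (x y z : List α) : Prop where
  solx : sub x U = sub x V
  soly : sub y U = sub y V
  solz : sub z U = sub z V
  ne : x ≠ []
  xy : x <+: y
  lxy : x.length < y.length
  yz : y <+: z
  lyz : y.length < z.length
  endU : ∃ U₀, U = U₀ ++ [none]
  endV : ∃ V₀, V = V₀ ++ x.map some ∧ x <+: sub [] V₀ ∧ sub [] V₀ <+: sub [] U
  startV : [none] <+: V
  gap : ∀ A B, At U A none → At V B none → cX B = cX A + 1 → (sub x B).length < (sub x A).length

namespace LSys

variable {U V : List (Option α)} {x y z : List α}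

lemma counts (L : LSys U V x y z) : cX U = cX V ∧ cC U = cC V :=
  counts_of_length L.lxy (by rw [L.solx]) (by rw [L.soly])

lemma length_pos (L : LSys U V x y z) : 0 < x.length := length_pos_iff.2 L.ne

/-- The next variable of V has one more x before it and still starts earlier, so it trails in
constants by more than |x|. -/
lemma gap' (L : LSys U V x y z) {A B} (hA : At U A none) (hB : At V B none)
    (h : cX B = cX A + 1) : cC B + x.length < cC A := by
  have := L.gap A B hA hB h
  rw [length_sub, length_sub x A, h] at this
  simp only [cC]
  nlinarith

lemma cX_lt (L : LSys U V x y z) {A c} (hA : At U A (some c)) : cX A < cX U := by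
  obtain ⟨U₀, rfl⟩ := L.endU
  rcases lt_or_ge A.length U₀.length with h | h
  · have := cX_mono (hA.of_lt (prefix_append _ _) h).pre
    simp; omega
  · have h1 := hA.eq_of_length (by have := hA.length_le; simp at this ⊢; omega)
    have := append_inj_right' h1 rfl
    simp at this

lemma start_at (L : LSys U V x y z) : At V [] none := L.startV

/-- Constants at equal positions among the constants of both sides. -/
lemma const_const (L : LSys U V x y z) {A B c d} (hA : At U A (some c)) (hB : At V B (some d))
    (h : cC A = cC B) : cX A < cX B := by
  by_contra hle
  push Not at hle
  have h1 := L.cX_lt hA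
  have h2 := L.counts.1
  obtain ⟨C, hC, hC'⟩ := exists_at_none (W := V) (j := cX B) (by omega)
  have h3 : At C B (some d) := by
    rcases hC.trichotomy hB with h3 | h3 | h3
    · simp at h3
    · have := h3.cX_lt; omega
    · exact h3
  have h4 := h3.cC_lt
  have hB1 : 1 ≤ cX B := by
    rcases L.start_at.trichotomy hB with h5 | h5 | h5
    · simp at h5
    · have := h5.cX_lt; omega
    · simp [At] at h5
  obtain ⟨D, hD, hD'⟩ := exists_at_none (W := U) (j := cX B - 1) (by omega)
  have h5 := L.gap' hD hC (by omega)
  rcases hD.trichotomy hA with h6 | h6 | h6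
  · simp at h6
  · have := cC_mono h6.pre; omega
  · have := cX_mono h6.pre; omega

/-- Variables with equal numbers of preceding variables. -/
lemma var_var (L : LSys U V x y z) {A B} (hA : At U A none) (hB : At V B none)
    (h : cX A = cX B) : cC B < cC A := by
  have h2 := L.counts.1
  rcases lt_or_ge (cX B + 1) (cX V) with hlt | hge
  · obtain ⟨C, hC, hC'⟩ := exists_at_none (W := V) hlt
    have h3 := L.gap' hA hC (by omega)
    rcases hC.trichotomy hB with h6 | h6 | h6
    · rw [h6.1] at hC'; omega
    · have := h6.cX_lt; omega
    · have := cC_mono h6.pre; omega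
  · obtain ⟨U₀, rfl⟩ := L.endU
    have hAU : A = U₀ := by
      rcases lt_or_ge A.length U₀.length with h' | h'
      · have := (hA.of_lt (prefix_append _ _) h').cX_lt
        simp at h2; omega
      · have h1 := hA.eq_of_length (by have := hA.length_le; simp at this ⊢; omega)
        exact append_inj_left' h1 rfl
    obtain ⟨V₀, rfl, -, -⟩ := L.endV
    have h4 := cC_mono hB.none_of_append_map.pre
    have h5 := L.counts.2
    have h6 := L.length_pos
    simp [cC] at h5
    rw [hAU]; simp only [cC] at h4 ⊢; omega

lemma var_const (L : LSys U V x y z) {A B c} (hA : At U A none) (hB : At V B (some c))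
    (h : cX A = cX B) : cC B < cC A := by
  have h1 := hA.cX_lt
  have h2 := L.counts.1
  obtain ⟨C, hC, hC'⟩ := exists_at_none (W := V) (j := cX B) (by omega)
  have h3 := L.var_var hA hC (by omega)
  rcases hC.trichotomy hB with h6 | h6 | h6
  · simp at h6
  · have := h6.cX_lt; omega
  · have := h6.cC_lt; omega

/-- Otherwise `gap'` at the preceding variable of U is violated. This is the one configuration that
survives in `height_le`. -/
lemma const_var (L : LSys U V x y z) {A B c} (hA : At U A (some c)) (hB : At V B none)
    (h : cX A = cX B) (hlt : cC A < cC B + x.length) : B = [] := by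
  rcases Nat.eq_zero_or_pos (cX B) with h0 | h0
  · rcases hB.trichotomy L.start_at with h6 | h6 | h6
    · exact h6.1
    · simp [At] at h6
    · have := h6.cX_lt; omega
  · have h1 := L.cX_lt hA
    obtain ⟨C, hC, hC'⟩ := exists_at_none (W := U) (j := cX B - 1) (by omega)
    have h3 := L.gap' hC hB (by omega)
    rcases hC.trichotomy hA with h6 | h6 | h6
    · simp at h6
    · have := cC_mono h6.pre; omega
    · have := cX_mono h6.pre; omega

end LSys

end Systems

/-! ### Prefix weights and the first position of extremal level -/

section Heights

variable {α : Type u}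

/-- The total weight of a word. -/
def wt (f : α → ℤ) (t : List α) : ℤ := (t.map f).sum

@[simp] lemma wt_nil (f : α → ℤ) : wt f [] = 0 := rfl
@[simp] lemma wt_cons (f : α → ℤ) (c t) : wt f (c :: t) = f c + wt f t := by simp [wt]
@[simp] lemma wt_append (f : α → ℤ) (s t) : wt f (s ++ t) = wt f s + wt f t := by simp [wt]
@[simp] lemma wt_reverse (f : α → ℤ) (t) : wt f t.reverse = wt f t := by
  induction t <;> simp_all [add_comm]
@[simp] lemma wt_neg (f : α → ℤ) (t) : wt (-f) t = - wt f t := by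
  induction t <;> simp_all [add_comm]

/-- The weight of a side when the variable has weight `s`. -/
def ht (f : α → ℤ) (s : ℤ) (W : List (Option α)) : ℤ := wt f (sub [] W) + s * cX W

@[simp] lemma ht_nil (f : α → ℤ) (s) : ht f s [] = 0 := by simp [ht]

lemma wt_sub (f : α → ℤ) (t : List α) (W) : wt f (sub t W) = ht f (wt f t) W := by
  unfold ht
  induction W using side_induction with
  | nil => simp
  | none W ih => simp [ih]; ring
  | some c W ih => simp [ih]; ring

/-- `q` is the shortest among the nonempty prefixes of `t` of maximal weight `M`. -/
structure MaxPre (f : α → ℤ) (t : List α) (M : ℤ) (q : List α) : Prop where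
  ne : q ≠ []
  pre : q <+: t
  wt : wt f q = M
  le : ∀ q', q' ≠ [] → q' <+: t → OneVar.wt f q' ≤ M
  min : ∀ q', q' ≠ [] → q' <+: t → OneVar.wt f q' = M → q.length ≤ q'.length

lemma exists_maxPre (f : α → ℤ) {t : List α} (ht : t ≠ []) : ∃ M q, MaxPre f t M q := by
  have hfin : {q | q ≠ [] ∧ q <+: t}.Finite := (finite_prefixes t).subset fun q h => h.2
  obtain ⟨q, ⟨h1, h2⟩, h3⟩ := Set.exists_max_image _ (wt f) hfin ⟨t, ht, prefix_rfl⟩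
  obtain ⟨q', ⟨h4, h5, h6⟩, h7⟩ := exists_shortest
    (P := fun r : List α => r ≠ [] ∧ r <+: t ∧ wt f r = wt f q) ⟨q, h1, h2, rfl⟩
  exact ⟨wt f q, q', h4, h5, h6, fun r hr hr' => h3 r ⟨hr, hr'⟩,
    fun r hr hr' he => h7 r ⟨hr, hr', he⟩⟩

/-- The symbol `o` after the prefix `A` reaches level `H + M`, for a variable whose values have
maximal prefix weight `M`. -/
def Ev (f : α → ℤ) (s H M : ℤ) (A : List (Option α)) : Option α → Prop
  | none => H ≤ ht f s A
  | some c => H + M ≤ ht f s (A ++ [some c])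

/-- The first symbol of `W` that reaches level `H + M`. -/
def IsFirst (f : α → ℤ) (s H M : ℤ) (W A : List (Option α)) (o : Option α) : Prop :=
  At W A o ∧ Ev f s H M A o ∧ ∀ B o', At W B o' → Ev f s H M B o' → A.length ≤ B.length

lemma exists_isFirst {f : α → ℤ} {s H M : ℤ} {W : List (Option α)}
    (h : ∃ A o, At W A o ∧ Ev f s H M A o) : ∃ A o, IsFirst f s H M W A o := by
  obtain ⟨A, ⟨o, h1, h2⟩, h3⟩ := exists_shortest
    (P := fun A : List (Option α) => ∃ o, At W A o ∧ Ev f s H M A o) h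
  exact ⟨A, o, h1, h2, fun B o' h4 h5 => h3 B ⟨o', h4, h5⟩⟩

/-- The part of the symbol `o` up to the position of maximal level. -/
def off (q : List α) : Option α → List α
  | none => q
  | some c => [c]

variable {f : α → ℤ} {s H M : ℤ} {t q : List α} {W A : List (Option α)} {o : Option α}

lemma ev_of_prefix (hs : wt f t = s) (hq : MaxPre f t M q) {p : List α} (hp : p ≠ [])
    (hpW : p <+: sub t W) (hl : H + M ≤ wt f p) :
    ∃ A o, At W A o ∧ Ev f s H M A o := by
  rcases prefix_sub_cases t hp hpW with ⟨A, c, hA, rfl⟩ | ⟨A, r, hA, h1, h2, rfl⟩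
  · refine ⟨A, some c, hA, ?_⟩
    have : sub t A ++ [c] = sub t (A ++ [some c]) := by simp
    rw [this, wt_sub, hs] at hl
    exact hl
  · refine ⟨A, none, hA, ?_⟩
    rw [wt_append, wt_sub, hs] at hl
    have := hq.le r h1 h2
    show H ≤ ht f s A
    omega

lemma prefix_of_ev (hs : wt f t = s) (hq : MaxPre f t M q) (hA : At W A o)
    (he : Ev f s H M A o) : sub t A ++ off q o ≠ [] ∧ sub t A ++ off q o <+: sub t W ∧
      H + M ≤ wt f (sub t A ++ off q o) := by
  cases o with
  | none =>
    refine ⟨by simp [off, hq.ne], hA.sub_none hq.pre, ?_⟩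
    rw [wt_append, wt_sub, hs, off, hq.wt]
    have : H ≤ ht f s A := he
    omega
  | some c =>
    refine ⟨by simp [off], hA.sub_some t, ?_⟩
    have : sub t A ++ [c] = sub t (A ++ [some c]) := by simp
    rw [off, this, wt_sub, hs]
    exact he

/-- As no variable starts above H, a prefix ending inside a variable reaches H + M only by starting
at H and using a prefix of t of weight M, hence one at least as long as q. -/
lemma first_prefix (hs : wt f t = s) (hq : MaxPre f t M q)
    (hH : ∀ B, At W B none → ht f s B ≤ H) (hF : IsFirst f s H M W A o) {p : List α}
    (hp : p ≠ []) (hpW : p <+: sub t W) (hl : H + M ≤ wt f p) :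
    (sub t A ++ off q o).length ≤ p.length := by
  obtain ⟨hA, he, hmin⟩ := hF
  have key : ∀ {B o'}, At W B o' → A.length ≤ B.length →
      (A = B ∧ o = o') ∨ sub t A ++ off q o <+: sub t B := by
    intro B o' hB hle
    rcases hA.trichotomy hB with h | h | h
    · exact Or.inl h
    · exact Or.inr (prefix_of_ev hs hq h he).2.1
    · have := h.length_le; simp at this; omega
  rcases prefix_sub_cases t hp hpW with ⟨B, c, hB, rfl⟩ | ⟨B, r, hB, h1, h2, rfl⟩
  · have hE : Ev f s H M B (some c) := by
      have : sub t B ++ [c] = sub t (B ++ [some c]) := by simp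
      rw [this, wt_sub, hs] at hl
      exact hl
    rcases key hB (hmin B _ hB hE) with ⟨rfl, rfl⟩ | h
    · simp [off]
    · have := h.length_le; simp at this ⊢; omega
  · rw [wt_append, wt_sub, hs] at hl
    have h3 := hq.le r h1 h2
    have h4 := hH B hB
    have hE : Ev f s H M B none := by show H ≤ ht f s B; omega
    rcases key hB (hmin B _ hB hE) with ⟨rfl, rfl⟩ | h
    · have := hq.min r h1 h2 (by omega)
      simp [off]; omega
    · have := h.length_le; simp at this ⊢; omega

/-- Both lengths are that of the shortest nonempty prefix of the common value reaching level H + M.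
-/
lemma first_sync {U V A B : List (Option α)} {o o' : Option α} (h : sub t U = sub t V)
    (hs : wt f t = s) (hq : MaxPre f t M q)
    (hU : ∀ B, At U B none → ht f s B ≤ H) (hV : ∀ B, At V B none → ht f s B ≤ H)
    (hA : IsFirst f s H M U A o) (hB : IsFirst f s H M V B o') :
    (sub t (A ++ (off q o).map some)).length = (sub t (B ++ (off q o').map some)).length := by
  have h1 := prefix_of_ev hs hq hA.1 hA.2.1
  have h2 := prefix_of_ev hs hq hB.1 hB.2.1
  simp only [sub_append, sub_map_some]
  exact le_antisymm (first_prefix hs hq hU hA h2.1 (h ▸ h2.2.1) h2.2.2)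
    (first_prefix hs hq hV hB h1.1 (h ▸ h1.2.1) h1.2.2)

lemma exists_isFirst_both {U V : List (Option α)} (h : sub t U = sub t V)
    (hs : wt f t = s) (hq : MaxPre f t M q)
    (he : (∃ A o, At U A o ∧ Ev f s H M A o) ∨ ∃ A o, At V A o ∧ Ev f s H M A o) :
    (∃ A o, IsFirst f s H M U A o) ∧ ∃ A o, IsFirst f s H M V A o := by
  rcases he with ⟨A, o, h1, h2⟩ | ⟨A, o, h1, h2⟩
  · have h3 := prefix_of_ev hs hq h1 h2
    exact ⟨exists_isFirst ⟨A, o, h1, h2⟩,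
      exists_isFirst (ev_of_prefix hs hq h3.1 (h ▸ h3.2.1) h3.2.2)⟩
  · have h3 := prefix_of_ev hs hq h1 h2
    exact ⟨exists_isFirst (ev_of_prefix hs hq h3.1 (h ▸ h3.2.1) h3.2.2),
      exists_isFirst ⟨A, o, h1, h2⟩⟩

end Heights

/-! ### Height bounds for a system -/

namespace LSys

variable {α : Type u} {U V : List (Option α)} {x y z : List α} {f : α → ℤ} {s : ℤ}

lemma exists_max_height (L : LSys U V x y z) (f : α → ℤ) (s : ℤ) : ∃ H : ℤ,
    (∀ B, At U B none → ht f s B ≤ H) ∧ (∀ B, At V B none → ht f s B ≤ H) ∧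
    ((∃ A, At U A none ∧ H ≤ ht f s A) ∨ ∃ A, At V A none ∧ H ≤ ht f s A) := by
  have hfin : {A | At U A none ∨ At V A none}.Finite :=
    ((finite_prefixes U).union (finite_prefixes V)).subset
      fun A h => h.imp (fun h => h.pre) fun h => h.pre
  obtain ⟨A, hA, hmax⟩ := Set.exists_max_image _ (ht f s) hfin ⟨[], Or.inr L.start_at⟩
  exact ⟨ht f s A, fun B hB => hmax B (Or.inl hB), fun B hB => hmax B (Or.inr hB),
    hA.imp (fun h => ⟨A, h, le_rfl⟩) fun h => ⟨A, h, le_rfl⟩⟩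

lemma constants_eq {U : List (Option α)} {A B c d V₀} (hV₀ : sub [] V₀ <+: sub [] U)
    (hA : At U A (some c)) (hB : At V₀ B (some d)) (h : cC A = cC B) :
    sub [] (A ++ [some c]) = sub [] (B ++ [some d]) :=
  (prefix_of_prefix_length_le (sub_prefix [] hA) ((sub_prefix [] hB).trans hV₀)
    (by simpa using h.le)).eq_of_length (by simpa using h)

/-- If `x` and `y` have the same maximal prefix weight, then this weight is nonpositive and no
variable starts at a positive height. -/
theorem height_le (L : LSys U V x y z) (hx : wt f x = s) (hy : wt f y = s) {M : ℤ} {q : List α}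
    (hq : MaxPre f x M q) (hM : ∀ q', q' ≠ [] → q' <+: y → wt f q' ≤ M) :
    s ≤ 0 ∧ (∀ B, At U B none → ht f s B ≤ 0) ∧ (∀ B, At V B none → ht f s B ≤ 0) := by
  have hq' : MaxPre f y M q := by
    refine ⟨hq.ne, hq.pre.trans L.xy, hq.wt, hM, fun r h1 h2 h3 => ?_⟩
    rcases le_total r.length x.length with h | h
    · exact hq.min r h1 (prefix_of_prefix_length_le h2 L.xy h) h3
    · exact hq.pre.length_le.trans h
  obtain ⟨H, hU, hV, hH⟩ := L.exists_max_height f s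
  -- No variable reaches H + 1 + M, so the first symbols to do so would be constants with equal
  -- counts before them, against `const_const`.
  have step1 : ¬ ((∃ A o, At U A o ∧ Ev f s (H + 1) M A o) ∨
      ∃ A o, At V A o ∧ Ev f s (H + 1) M A o) := by
    intro he
    obtain ⟨⟨A, o, hA⟩, B, o', hB⟩ := exists_isFirst_both L.solx hx hq he
    have hU' : ∀ B, At U B none → ht f s B ≤ H + 1 := fun B hB => by have := hU B hB; omega
    have hV' : ∀ B, At V B none → ht f s B ≤ H + 1 := fun B hB => by have := hV B hB; omega
    obtain ⟨h1, h2⟩ := counts_of_length L.lxy (first_sync L.solx hx hq hU' hV' hA hB)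
      (first_sync L.soly hy hq' hU' hV' hA hB)
    cases o with
    | none =>
      have := hU A hA.1
      have : H + 1 ≤ ht f s A := hA.2.1
      omega
    | some c =>
      cases o' with
      | none =>
        have := hV B hB.1
        have : H + 1 ≤ ht f s B := hB.2.1
        omega
      | some d =>
        simp [off] at h1 h2
        have := L.const_const hA.1 hB.1 h2
        omega
  obtain ⟨⟨A, o, hA⟩, B, o', hB⟩ := exists_isFirst_both (H := H) L.solx hx hq
    (hH.imp (fun ⟨A, h, h'⟩ => ⟨A, none, h, h'⟩) fun ⟨A, h, h'⟩ => ⟨A, none, h, h'⟩)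
  obtain ⟨h1, h2⟩ := counts_of_length L.lxy (first_sync L.solx hx hq hU hV hA hB)
    (first_sync L.soly hy hq' hU hV hA hB)
  have hql := length_pos_iff.2 hq.ne
  have hqx := hq.pre.length_le
  simp at h1 h2
  cases o with
  | none =>
    cases o' with
    | none =>
      have := L.var_var hA.1 hB.1 h1
      simp [off, cC] at h2 this; omega
    | some d =>
      have := L.var_const hA.1 hB.1 h1
      simp [off, cC] at h2 this; omega
  | some c =>
    cases o' with
    | some d =>
      have := L.const_const hA.1 hB.1 (by simpa [off] using h2)
      omega
    | none =>
      have hB0 : B = [] := L.const_var hA.1 hB.1 h1 (by simp [off, cC] at h2 ⊢; omega)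
      subst hB0
      have hH0 : H ≤ 0 := by simpa [Ev] using hB.2.1
      refine ⟨?_, fun B hB => (hU B hB).trans hH0, fun B hB => (hV B hB).trans hH0⟩
      -- If s > 0, the constant of V with the same index as that of U stands behind more variables,
      -- hence reaches H + 1 + M. It exists within V₀ because |q| ≤ |x| ≤ `cC V₀`.
      by_contra hs
      push Not at hs
      obtain ⟨V₀, hVe, hxV, hVU⟩ := L.endV
      have hk : cC A < cC V₀ := by
        have := hxV.length_le
        simp [off, cC] at h2 this ⊢; omega
      obtain ⟨C, d, hC, hC'⟩ := exists_at_some hk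
      have hCV : At V C (some d) := hC.mono (hVe ▸ prefix_append _ _)
      have h3 := L.const_const hA.1 hCV hC'.symm
      have h4 := constants_eq hVU hA.1 hC hC'.symm
      refine step1 (Or.inr ⟨C, some d, hCV, ?_⟩)
      have h5 : H + M ≤ ht f s (A ++ [some c]) := hA.2.1
      show H + 1 + M ≤ ht f s (C ++ [some d])
      simp only [ht, h4, cX_append] at h5 ⊢
      simp at h5 h1 ⊢
      rw [h1] at h5
      have : s * 1 ≤ s * cX C := by
        apply mul_le_mul_of_nonneg_left _ hs.le
        omega
      simp at h5
      omega

/-- If the common weight is nonpositive, then `x` and `y` have the same maximal prefix weight. -/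
theorem maxPre_le (L : LSys U V x y z) (hx : wt f x = s) (hy : wt f y = s) (hz : wt f z = s)
    (hs : s ≤ 0) {M : ℤ} {q : List α} (hq : MaxPre f x M q) :
    ∀ q', q' ≠ [] → q' <+: y → wt f q' ≤ M := by
  by_contra hcon
  push Not at hcon
  obtain ⟨q₀, hq1, hq2, hq3⟩ := hcon
  obtain ⟨My, qy, hqy⟩ := exists_maxPre f (t := y) (by rintro rfl; exact hq1 (prefix_nil.1 hq2))
  obtain ⟨Mz, qz, hqz⟩ := exists_maxPre f (t := z) (by
    rintro rfl; exact hq1 (prefix_nil.1 (hq2.trans L.yz)))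
  have hMy : M < My := hq3.trans_le (hqy.le q₀ hq1 hq2)
  have hMz : M < Mz := hq3.trans_le (hqz.le q₀ hq1 (hq2.trans L.yz))
  obtain ⟨H, hU, hV, hH⟩ := L.exists_max_height f s
  -- A shortest prefix p exceeding this level with maximal weight would end at a constant. The
  -- equally indexed constant of U has fewer variables before it: it comes earlier and, since s ≤ 0,
  -- is at least as high.
  have low : ∀ p, p ≠ [] → p <+: sub x U → wt f p ≤ H + M := by
    by_contra hcon
    push Not at hcon
    obtain ⟨p₀, hp1, hp2, hp3⟩ := hcon
    obtain ⟨K, p, hp⟩ := exists_maxPre f (t := sub x U) (by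
      intro h; rw [h] at hp2; exact hp1 (prefix_nil.1 hp2))
    have hK : H + M < wt f p := by rw [hp.wt]; exact hp3.trans_le (hp.le p₀ hp1 hp2)
    have hpV : p <+: sub x V := L.solx ▸ hp.pre
    have inVar : ∀ {W A r}, (∀ B, At W B none → ht f s B ≤ H) → At W A none → r ≠ [] →
        r <+: x → p ≠ sub x A ++ r := by
      rintro W A r hW hA h1 h2 rfl
      rw [wt_append, wt_sub, hx] at hK
      have := hq.le r h1 h2
      have := hW A hA
      omega
    obtain ⟨V₀, hVe, hxV, hVU⟩ := L.endV
    obtain ⟨U₀, hUe⟩ := L.endU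
    rcases prefix_sub_cases x hp.ne hpV with ⟨B, c, hB, hpB⟩ | ⟨A, r, hA, h1, h2, h3⟩
    · rcases lt_or_ge B.length V₀.length with hlt | hge
      · have hB' : At V₀ B (some c) := hB.of_lt (hVe ▸ prefix_append _ _) hlt
        have hk : cC B < cC U := hB'.cC_lt.trans_le hVU.length_le
        obtain ⟨A, d, hA, hA'⟩ := exists_at_some hk
        have h3 := L.const_const hA hB hA'
        have h4 := constants_eq hVU hA hB' hA'
        have h5 : wt f (sub x A ++ [d]) = ht f s (A ++ [some d]) := by
          rw [← hx, ← wt_sub]; simp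
        have h6 : wt f p = ht f s (B ++ [some c]) := by
          rw [← hx, ← wt_sub, hpB]; simp
        have h7 : wt f p ≤ wt f (sub x A ++ [d]) := by
          rw [h5, h6]
          simp only [ht, h4, cX_append, cX_some, cX_nil]
          have : s * (cX B + 0 : ℕ) ≤ s * (cX A + 0 : ℕ) := by
            apply mul_le_mul_of_nonpos_left _ hs
            exact_mod_cast h3.le
          omega
        have h8 := hp.min (sub x A ++ [d]) (by simp) (hA.sub_some x)
          (le_antisymm (hp.le _ (by simp) (hA.sub_some x)) (hp.wt ▸ h7))
        rw [hpB, length_append, length_append, length_sub, length_sub x A] at h8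
        have h9 : cX A * x.length < cX B * x.length := Nat.mul_lt_mul_of_pos_right h3 L.length_pos
        simp only [cC] at hA'
        simp at h8
        omega
      -- After V₀ only the closing x remains, aligned with the last variable of U, so p ends inside
      -- a variable after all.
      · have h1 : (sub x V₀).length = (sub x U₀).length := by
          have := congrArg length L.solx
          rw [hUe, hVe] at this
          simp at this; omega
        have h2 : V₀ <+: B :=
          prefix_of_prefix_length_le (hVe ▸ prefix_append _ _) hB.pre hge
        have h3 := (sub_prefix x h2).length_le
        have h4 : (sub x U₀).length < p.length := by rw [hpB]; simp; omega
        have hUA : At U U₀ none := by rw [hUe]; exact prefix_rfl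
        obtain ⟨r, rfl⟩ : sub x U₀ <+: p :=
          prefix_of_prefix_length_le (sub_prefix x hUA.pre) hp.pre h4.le
        refine inVar hU hUA (r := r) ?_ ?_ rfl
        · rintro rfl; simp at h4
        · have := hp.pre
          rw [hUe] at this
          simpa [prefix_append_right_inj] using this
    · exact inVar hV hA h1 h2 h3
  have lowW : ∀ W, (W = U ∨ W = V) → ∀ A c, At W A (some c) → ht f s (A ++ [some c]) ≤ H + M := by
    intro W hW A c hA
    have := low (sub x A ++ [c]) (by simp) (by
      rcases hW with rfl | rfl
      · exact hA.sub_some x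
      · rw [L.solx]; exact hA.sub_some x)
    rw [← hx, ← wt_sub]; simpa using this
  have first : ∀ M', M < M' → ∀ W, (W = U ∨ W = V) → ∀ A o, At W A o → Ev f s H M' A o →
      o = none := by
    intro M' hM' W hW A o hA he
    cases o with
    | none => rfl
    | some c =>
      have h1 := lowW W hW A c hA
      have h2 : H + M' ≤ ht f s (A ++ [some c]) := he
      omega
  -- Whether a variable reaches the level does not depend on M, so y and z share their first
  -- symbols; two lengths then equate counts, against `var_var`.
  have trans : ∀ W, (W = U ∨ W = V) → ∀ A, IsFirst f s H My W A none →
      IsFirst f s H Mz W A none := by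
    intro W hW A hA
    refine ⟨hA.1, hA.2.1, fun B o hB he => ?_⟩
    have := first Mz hMz W hW B o hB he
    subst this
    exact hA.2.2 B none hB he
  obtain ⟨⟨A, o, hA⟩, B, o', hB⟩ := exists_isFirst_both (H := H) L.soly hy hqy
    (hH.imp (fun ⟨A, h, h'⟩ => ⟨A, none, h, h'⟩) fun ⟨A, h, h'⟩ => ⟨A, none, h, h'⟩)
  obtain rfl := first My hMy U (Or.inl rfl) A o hA.1 hA.2.1
  obtain rfl := first My hMy V (Or.inr rfl) B o' hB.1 hB.2.1
  have e1 := first_sync L.soly hy hqy hU hV hA hB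
  have e2 := first_sync L.solz hz hqz hU hV (trans U (Or.inl rfl) A hA)
    (trans V (Or.inr rfl) B hB)
  obtain ⟨h1, h2⟩ := counts_of_length (A := A) (B := B) L.lyz (by simpa using e1)
    (by simpa using e2)
  exact (L.var_var hA.1 hB.1 h1).ne' h2

end LSys

/-! ### Common weights vanish -/

section Balance

variable {α : Type u} {U V U' V' : List (Option α)} {x y z : List α} {f : α → ℤ} {s : ℤ}

/-- For s > 0, `maxPre_le` for −f shows that y has no prefix lighter than the lightest one of x.
Complementing, no suffix of y is heavier than the heaviest one of x, so `height_le` applies to the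
reversed system. -/
lemma LSys.weight_nonpos (L : LSys U V x y z) (R : LSys U' V' x.reverse y.reverse z.reverse)
    (hx : wt f x = s) (hy : wt f y = s) (hz : wt f z = s) : s ≤ 0 := by
  by_contra hs
  push Not at hs
  obtain ⟨M, q, hq⟩ := exists_maxPre (-f) L.ne
  obtain ⟨M', q', hq'⟩ := exists_maxPre f R.ne
  have h1 := L.maxPre_le (s := -s) (f := -f) (by simp [hx]) (by simp [hy]) (by simp [hz])
    (by omega) hq
  have hqM := hq.wt
  rw [wt_neg] at hqM
  have h2 : s ≤ M' := by
    have := hq'.le x.reverse R.ne prefix_rfl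
    simpa [hx] using this
  refine absurd (R.height_le (s := s) (by simp [hx]) (by simp [hy]) hq' ?_).1 (by omega)
  intro r hr hry
  obtain ⟨p, hp⟩ := reverse_suffix.2 hry
  rw [reverse_reverse] at hp
  have h3 : wt f p + wt f r = s := by
    have := congrArg (wt f) hp
    simpa [hy] using this
  rcases eq_or_ne p [] with rfl | hp0
  · simp at h3; omega
  have h4 := h1 p hp0 ⟨_, hp⟩
  rw [wt_neg] at h4
  obtain ⟨w, hw⟩ := hq.pre
  have h5 : wt f q + wt f w = s := by
    have := congrArg (wt f) hw
    simpa [hx] using this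
  rcases eq_or_ne w [] with rfl | hw0
  · simp at h5; omega
  · have h6 := hq'.le w.reverse (by simpa using hw0) (by rw [← hw, reverse_append]; simp)
    simp at h6; omega

lemma LSys.weight_eq_zero (L : LSys U V x y z) (R : LSys U' V' x.reverse y.reverse z.reverse)
    (hx : wt f x = s) (hy : wt f y = s) (hz : wt f z = s) : s = 0 := by
  have h1 := L.weight_nonpos R hx hy hz
  have h2 := L.weight_nonpos (s := -s) (f := -f) R (by simp [hx]) (by simp [hy]) (by simp [hz])
  omega

/-- All blocks of constants between consecutive variables have weight zero. -/
def Flat (f : α → ℤ) (W : List (Option α)) : Prop :=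
  wt f (sub [] W) = 0 ∧ ∀ A, At W A none → wt f (sub [] A) = 0

/-- For s = 0 the height of a variable is the weight of the constants before it, bounded by 0 from
both sides through f and −f. -/
lemma LSys.flat (L : LSys U V x y z) (hx : wt f x = 0) (hy : wt f y = 0) (hz : wt f z = 0) :
    Flat f U ∧ Flat f V := by
  obtain ⟨M, q, hq⟩ := exists_maxPre f L.ne
  obtain ⟨M', q', hq'⟩ := exists_maxPre (-f) L.ne
  have hx' : wt (-f) x = 0 := by simp [hx]
  have hy' : wt (-f) y = 0 := by simp [hy]
  have hz' : wt (-f) z = 0 := by simp [hz]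
  have h1 := L.height_le hx hy hq (L.maxPre_le hx hy hz le_rfl hq)
  have h2 := L.height_le hx' hy' hq' (L.maxPre_le hx' hy' hz' le_rfl hq')
  simp only [ht, zero_mul, add_zero, wt_neg] at h1 h2
  have hU : ∀ A, At U A none → wt f (sub [] A) = 0 := fun A hA => by
    have := h1.2.1 A hA; have := h2.2.1 A hA; omega
  have hV : ∀ A, At V A none → wt f (sub [] A) = 0 := fun A hA => by
    have := h1.2.2 A hA; have := h2.2.2 A hA; omega
  have h3 : wt f (sub [] U) = 0 := by
    obtain ⟨U₀, rfl⟩ := L.endU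
    simpa using hU U₀ prefix_rfl
  refine ⟨⟨h3, hU⟩, ?_, hV⟩
  have := congrArg (wt f) L.solx
  rw [wt_sub, wt_sub, hx] at this
  simpa [ht, h3] using this.symm

end Balance

/-! ### First moments and the existence of a common weight -/

section Area

variable {α : Type u} {U V : List (Option α)} {x y z : List α}

/-- The number of constants before the `j`-th variable. -/
def varPos : List (Option α) → ℕ → ℕ
  | [], _ => 0
  | none :: _, 0 => 0
  | none :: W, j + 1 => varPos W j
  | some _ :: W, j => varPos W j + 1

lemma gam_eq_sum (W : List (Option α)) : gam W = ∑ j ∈ Finset.range (cX W), varPos W j := by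
  induction W using side_induction with
  | nil => simp [gam]
  | none W ih => simp [gam, ih, Finset.sum_range_succ', varPos]
  | some c W ih => simp [gam, ih, varPos, Finset.sum_add_distrib]

lemma At.varPos_eq {W : List (Option α)} : ∀ {A}, At W A none → varPos W (cX A) = cC A := by
  induction W using side_induction with
  | nil => intro A h; simp [At] at h
  | none W ih =>
    intro A h
    match A with
    | [] => rfl
    | o :: A =>
      obtain ⟨rfl, h'⟩ := cons_prefix_cons.1 h
      exact ih h'
  | some c W ih =>
    intro A h
    match A with
    | [] => simp [At] at h
    | o :: A =>
      obtain ⟨rfl, h'⟩ := cons_prefix_cons.1 h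
      simp [varPos, ih h', cC]

lemma LSys.gam_lt (L : LSys U V x y z) : gam V < gam U := by
  rw [gam_eq_sum, gam_eq_sum, L.counts.1]
  apply Finset.sum_lt_sum_of_nonempty
  · exact Finset.nonempty_range_iff.2 (by have := L.start_at.cX_lt; omega)
  · intro j hj
    rw [Finset.mem_range] at hj
    obtain ⟨B, hB, rfl⟩ := exists_at_none hj
    obtain ⟨A, hA, h⟩ := exists_at_none (W := U) (j := cX B) (by rw [L.counts.1]; exact hj)
    have := L.var_var hA hB h
    rw [hB.varPos_eq, ← h, hA.varPos_eq]
    exact this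

/-- The sum, over the letters of a word, of the weight times the position. -/
def ar (f : α → ℤ) : List α → ℤ
  | [] => 0
  | _ :: t => ar f t + wt f t

lemma ar_append (f : α → ℤ) (s t : List α) :
    ar f (s ++ t) = ar f s + ar f t + s.length * wt f t := by
  induction s with
  | nil => simp [ar]
  | cons c s ih => simp [ar, ih]; ring

/-- The first two terms depend on W only through `cX W` and cancel between the sides; beyond an
affine function of |t|, only the `gam` term remains. -/
lemma exists_ar_sub (f : α → ℤ) (W : List (Option α)) : ∃ a b : ℤ, ∀ t : List α,
    ar f (sub t W) = cX W * ar f t + (cX W).choose 2 * t.length * wt f t + a + b * t.length +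
      gam W * wt f t := by
  induction W using side_induction with
  | nil => exact ⟨0, 0, fun t => by simp [ar, gam]⟩
  | none W ih =>
    obtain ⟨a, b, h⟩ := ih
    refine ⟨a, b + wt f (sub [] W), fun t => ?_⟩
    rw [sub_none, ar_append, h, wt_sub, ht, cX_none, Nat.choose_succ_succ' _ 1]
    simp [gam]; ring
  | some c W ih =>
    obtain ⟨a, b, h⟩ := ih
    refine ⟨a + wt f (sub [] W), b, fun t => ?_⟩
    rw [sub_some, ar, h, wt_sub, ht]
    simp [gam]; ring

/-- The factor A is the difference of the two `gam`, nonzero by `gam_lt`. It is the same for all f,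
so |t| can be eliminated between two weights. -/
lemma LSys.area (L : LSys U V x y z) : ∃ A : ℤ, A ≠ 0 ∧ ∀ f : α → ℤ, ∃ a b : ℤ,
    ∀ t, sub t U = sub t V → A * wt f t = a + b * t.length := by
  refine ⟨gam U - gam V, ?_, fun f => ?_⟩
  · have := L.gam_lt; omega
  · obtain ⟨a, b, h⟩ := exists_ar_sub f U
    obtain ⟨a', b', h'⟩ := exists_ar_sub f V
    refine ⟨a' - a, b' - b, fun t ht => ?_⟩
    have := h' t
    rw [← ht, h t, L.counts.1] at this
    linear_combination this

lemma wt_lin (f g : α → ℤ) (a b : ℤ) (t : List α) :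
    wt (fun c => a * f c + b * g c) t = a * wt f t + b * wt g t := by
  induction t with
  | nil => simp
  | cons c t ih => simp [ih]; ring

/-- Unless `z` uses a single letter, some weight function that does not vanish on `z` takes the
same value on `x`, `y` and `z`. -/
lemma LSys.exists_weight (L : LSys U V x y z) : (∃ c, ∀ b ∈ z, b = c) ∨
    ∃ f : α → ℤ, wt f x = wt f z ∧ wt f y = wt f z ∧ ∃ c ∈ z, f c ≠ 0 := by
  classical
  by_cases hone : ∃ c, ∀ b ∈ z, b = c
  · exact Or.inl hone
  right
  push Not at hone
  obtain ⟨A, hA, h⟩ := L.area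
  have hz : z ≠ [] := length_pos_iff.1 (by have := L.lyz; omega)
  obtain ⟨c, z', hzz⟩ := exists_cons_of_ne_nil hz
  have hc : c ∈ z := by simp [hzz]
  obtain ⟨d, hd, hdc⟩ := hone c
  obtain ⟨a₁, b₁, h₁⟩ := h (Pi.single c 1)
  obtain ⟨a₂, b₂, h₂⟩ := h (Pi.single d 1)
  have mk : ∀ f : α → ℤ, (∃ k, ∀ t, sub t U = sub t V → A * wt f t = k) →
      (∃ c ∈ z, f c ≠ 0) → ∃ f : α → ℤ, wt f x = wt f z ∧ wt f y = wt f z ∧ ∃ c ∈ z, f c ≠ 0 := by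
    rintro f ⟨k, hk⟩ hf
    exact ⟨f, mul_left_cancel₀ hA ((hk x L.solx).trans (hk z L.solz).symm),
      mul_left_cancel₀ hA ((hk y L.soly).trans (hk z L.solz).symm), hf⟩
  by_cases hb₁ : b₁ = 0
  · refine mk (Pi.single c 1) ⟨a₁, fun t ht => by rw [h₁ t ht, hb₁]; ring⟩ ⟨c, hc, by simp⟩
  -- This combination cancels the length terms and takes the value −b₁ ≠ 0 at d.
  · refine mk (fun e => b₂ * (Pi.single c 1 : α → ℤ) e + (-b₁) * (Pi.single d 1 : α → ℤ) e)
      ⟨b₂ * a₁ - b₁ * a₂, fun t ht => ?_⟩ ⟨d, hd, by simp [hdc, hb₁]⟩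
    rw [wt_lin]
    linear_combination b₂ * h₁ t ht - b₁ * h₂ t ht

end Area

/-! ### Recoding by factors of weight zero -/

section Recoding

variable {α β : Type u}

/-- Recoding of the blocks of constants of a side by `D`. -/
def recode (D : List α → List β) : List α → List (Option α) → List (Option β)
  | acc, [] => (D acc).map some
  | acc, none :: W => (D acc).map some ++ none :: recode D [] W
  | acc, some c :: W => recode D (acc ++ [c]) W

variable {D : List α → List β} {f : α → ℤ}

lemma cX_recode (W : List (Option α)) : ∀ acc, cX (recode D acc W) = cX W := by
  induction W using side_induction with
  | nil => simp [recode]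
  | none W ih => simp [recode, ih]
  | some c W ih => simp [recode, ih]

lemma recode_append_none (W₁ W₂ : List (Option α)) : ∀ acc,
    recode D acc (W₁ ++ none :: W₂) = recode D acc W₁ ++ none :: recode D [] W₂ := by
  induction W₁ using side_induction with
  | nil => simp [recode]
  | none W ih => simp [recode, ih]
  | some c W ih => simp [recode, ih]

lemma recode_map_some (v : List α) : ∀ acc,
    recode D acc (v.map some) = (D (acc ++ v)).map some := by
  induction v with
  | nil => simp [recode]
  | cons c v ih => simp [recode, ih]

lemma at_append_map {W A : List (Option β)} : ∀ {v : List β},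
    At (v.map some ++ none :: W) A none →
    A = v.map some ∨ ∃ A', A = v.map some ++ none :: A' ∧ At W A' none := by
  intro v
  induction v generalizing A with
  | nil =>
    intro h
    match A with
    | [] => exact Or.inl rfl
    | o :: A =>
      obtain ⟨rfl, h'⟩ := cons_prefix_cons.1 h
      exact Or.inr ⟨A, rfl, h'⟩
  | cons c v ih =>
    intro h
    match A with
    | [] => simp [At] at h
    | o :: A =>
      obtain ⟨rfl, h'⟩ := cons_prefix_cons.1 h
      rcases ih h' with rfl | ⟨A', rfl, hA'⟩
      · exact Or.inl rfl
      · exact Or.inr ⟨A', rfl, hA'⟩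

lemma at_recode {W : List (Option α)} : ∀ {acc A}, At (recode D acc W) A none →
    ∃ B, At W B none ∧ A = recode D acc B := by
  induction W using side_induction with
  | nil => intro acc A h; have := h.cX_lt; simp [recode] at this
  | none W ih =>
    intro acc A h
    rcases at_append_map h with rfl | ⟨A', rfl, h'⟩
    · exact ⟨[], at_nil _ _, rfl⟩
    · obtain ⟨B, hB, rfl⟩ := ih h'
      exact ⟨none :: B, hB.cons _, rfl⟩
  | some c W ih =>
    intro acc A h
    obtain ⟨B, hB, rfl⟩ := ih h
    exact ⟨some c :: B, hB.cons _, rfl⟩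

/-- `D` is multiplicative on words of weight zero, and has no kernel there. -/
structure Coding (f : α → ℤ) (D : List α → List β) : Prop where
  append : ∀ u v, wt f u = 0 → wt f v = 0 → D (u ++ v) = D u ++ D v
  eq_nil : ∀ u, wt f u = 0 → D u = [] → u = []

namespace Coding

lemma nil (hD : Coding f D) : D [] = [] := by
  have := congrArg length (hD.append [] [] rfl rfl)
  simp at this; exact this

lemma pre (hD : Coding f D) {u v : List α} (hu : wt f u = 0) (hv : wt f v = 0) (h : u <+: v) :
    D u <+: D v := by
  obtain ⟨w, rfl⟩ := h
  rw [hD.append u w hu (by simpa [hu] using hv)]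
  exact prefix_append _ _

lemma length_lt (hD : Coding f D) {u v : List α} (hu : wt f u = 0) (hv : wt f v = 0)
    (h : u <+: v) (hl : u.length < v.length) : (D u).length < (D v).length := by
  obtain ⟨w, rfl⟩ := h
  have hw : wt f w = 0 := by simpa [hu] using hv
  rw [hD.append u w hu hw, length_append]
  have : D w ≠ [] := fun h => by simp [hD.eq_nil w hw h] at hl
  have := length_pos_iff.2 this
  omega

/-- Here `acc` is the part of the current block already read; D splits at variables because
completed blocks have weight zero. -/
lemma sub_recode_aux (hD : Coding f D) {t : List α} (ht : wt f t = 0) (W : List (Option α)) :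
    ∀ acc, wt f acc + wt f (sub [] W) = 0 →
      (∀ A, At W A none → wt f acc + wt f (sub [] A) = 0) →
      sub (D t) (recode D acc W) = D (acc ++ sub t W) := by
  induction W using side_induction with
  | nil => intro acc _ _; simp [recode]
  | none W ih =>
    intro acc h1 h2
    have h3 : wt f acc = 0 := by simpa using h2 [] (at_nil _ _)
    simp only [h3, zero_add, sub_none, nil_append] at h1
    have h4 : wt f (sub t W) = 0 := by rw [wt_sub, ht]; simp [OneVar.ht, h1]
    rw [sub_none, hD.append _ _ h3 (by simp [ht, h4]), hD.append _ _ ht h4, recode, sub_append,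
      sub_map_some, sub_none, ih [] (by simpa using h1), nil_append]
    intro A hA
    have := h2 (none :: A) (hA.cons _)
    simpa [h3] using this
  | some c W ih =>
    intro acc h1 h2
    rw [recode, ih]
    · simp
    · simpa [add_assoc] using h1
    · intro A hA
      have := h2 (some c :: A) (hA.cons _)
      simpa [add_assoc] using this

lemma sub_recode (hD : Coding f D) {t : List α} (ht : wt f t = 0) {W : List (Option α)}
    (hW : Flat f W) : sub (D t) (recode D [] W) = D (sub t W) :=
  hD.sub_recode_aux ht W [] (by simpa using hW.1) fun A hA => by simpa using hW.2 A hA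

lemma recode_append_map (hD : Coding f D) {v : List α} (hv : wt f v = 0) (W : List (Option α)) :
    ∀ acc, wt f acc + wt f (sub [] W) = 0 →
      (∀ A, At W A none → wt f acc + wt f (sub [] A) = 0) →
      recode D acc (W ++ v.map some) = recode D acc W ++ (D v).map some := by
  induction W using side_induction with
  | nil =>
    intro acc h _
    rw [nil_append, recode_map_some, hD.append _ _ (by simpa using h) hv, map_append]; rfl
  | none W ih =>
    intro acc h1 h2
    have h3 : wt f acc = 0 := by simpa using h2 [] (at_nil _ _)
    rw [cons_append, recode, ih, recode, append_assoc, cons_append]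
    · simpa [h3] using h1
    · intro A hA
      have := h2 (none :: A) (hA.cons _)
      simpa [h3] using this
  | some c W ih =>
    intro acc h1 h2
    rw [cons_append, recode, ih, recode]
    · simpa [add_assoc] using h1
    · intro A hA
      have := h2 (some c :: A) (hA.cons _)
      simpa [add_assoc] using this

end Coding

lemma Flat.of_at {W A : List (Option α)} (h : Flat f W) (hA : At W A none) : Flat f A :=
  ⟨h.2 A hA, fun B hB => h.2 B (hB.mono hA.pre)⟩

/-- By `flat` all cuts at variables fall at weight zero, where D is multiplicative; strict
inequalities survive because D kills no nonempty word of weight zero. -/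
theorem LSys.recode {U V : List (Option α)} {x y z : List α} (L : LSys U V x y z)
    (hD : Coding f D) (hx : wt f x = 0) (hy : wt f y = 0) (hz : wt f z = 0) :
    LSys (recode D [] U) (recode D [] V) (D x) (D y) (D z) := by
  obtain ⟨hU, hV⟩ := L.flat hx hy hz
  refine ⟨?_, ?_, ?_, fun h => L.ne (hD.eq_nil x hx h), hD.pre hx hy L.xy,
    hD.length_lt hx hy L.xy L.lxy, hD.pre hy hz L.yz, hD.length_lt hy hz L.yz L.lyz,
    ?_, ?_, ?_, ?_⟩
  · rw [hD.sub_recode hx hU, hD.sub_recode hx hV, L.solx]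
  · rw [hD.sub_recode hy hU, hD.sub_recode hy hV, L.soly]
  · rw [hD.sub_recode hz hU, hD.sub_recode hz hV, L.solz]
  · obtain ⟨U₀, rfl⟩ := L.endU
    exact ⟨OneVar.recode D [] U₀, by rw [recode_append_none]; simp [OneVar.recode, hD.nil]⟩
  · obtain ⟨V₀, rfl, h1, h2⟩ := L.endV
    have hV₀ : Flat f V₀ := by
      refine ⟨by simpa [hx] using hV.1, fun A hA => hV.2 A (hA.mono (prefix_append _ _))⟩
    have e : ∀ {W}, Flat f W → sub [] (OneVar.recode D [] W) = D (sub [] W) := by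
      intro W hW
      have := hD.sub_recode (t := []) rfl hW
      rwa [hD.nil] at this
    refine ⟨OneVar.recode D [] V₀, hD.recode_append_map hx V₀ [] (by simpa using hV₀.1)
      fun A hA => by simpa using hV₀.2 A hA, ?_, ?_⟩
    · rw [e hV₀]; exact hD.pre hx hV₀.1 h1
    · rw [e hV₀, e hU]; exact hD.pre hV₀.1 hU.1 h2
  · obtain ⟨W, rfl⟩ := L.startV
    simp [OneVar.recode, hD.nil]
  · intro A B hA hB h
    obtain ⟨A, hA', rfl⟩ := at_recode hA
    obtain ⟨B, hB', rfl⟩ := at_recode hB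
    rw [cX_recode, cX_recode] at h
    have h1 := L.gap A B hA' hB' h
    have fA := hU.of_at hA'
    have fB := hV.of_at hB'
    rw [hD.sub_recode hx fA, hD.sub_recode hx fB]
    have z : ∀ {W}, Flat f W → wt f (sub x W) = 0 := fun hW => by
      rw [wt_sub, hx]; simp [ht, hW.1]
    exact hD.length_lt (z fB) (z fA) (prefix_of_prefix_length_le
      (L.solx ▸ sub_prefix x hB'.pre) (sub_prefix x hA'.pre) h1.le) h1

/-- Decomposition into factors of weight zero that have no proper prefix of weight zero. -/
def dec (f : α → ℤ) : List α → List α → List (List α)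
  | _, [] => []
  | acc, c :: t => if wt f (acc ++ [c]) = 0 then (acc ++ [c]) :: dec f [] t
      else dec f (acc ++ [c]) t

lemma dec_append (u v : List α) : ∀ acc, wt f acc + wt f u = 0 → (acc = [] ∨ wt f acc ≠ 0) →
    dec f acc (u ++ v) = dec f acc u ++ dec f [] v := by
  induction u with
  | nil =>
    intro acc h h'
    rcases h' with rfl | h'
    · rfl
    · simp at h; exact absurd h h'
  | cons c u ih =>
    intro acc h _
    rw [cons_append, dec, dec]
    have h1 : wt f (acc ++ [c]) + wt f u = 0 := by simpa [add_assoc] using h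
    split_ifs with hc
    · rw [ih [] (by simpa [hc] using h1) (Or.inl rfl), cons_append]
    · rw [ih _ h1 (Or.inr hc)]

lemma flatten_dec (u : List α) : ∀ acc, wt f acc + wt f u = 0 → (acc = [] ∨ wt f acc ≠ 0) →
    (dec f acc u).flatten = acc ++ u := by
  induction u with
  | nil =>
    intro acc h h'
    rcases h' with rfl | h'
    · rfl
    · simp at h; exact absurd h h'
  | cons c u ih =>
    intro acc h _
    rw [dec]
    have h1 : wt f (acc ++ [c]) + wt f u = 0 := by simpa [add_assoc] using h
    split_ifs with hc
    · rw [flatten_cons, ih [] (by simpa [hc] using h1) (Or.inl rfl)]; simp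
    · rw [ih _ h1 (Or.inr hc)]; simp

lemma length_dec_le (u : List α) : ∀ acc, (dec f acc u).length ≤ u.length := by
  induction u with
  | nil => simp [dec]
  | cons c u ih =>
    intro acc
    rw [dec]
    split_ifs
    · simpa using ih []
    · exact (ih _).trans (by simp)

/-- A letter of nonzero weight is never a factor by itself, so there are fewer factors than letters.
-/
lemma length_dec_lt {u : List α} (h : ∃ c ∈ u, f c ≠ 0) : (dec f [] u).length < u.length := by
  induction u with
  | nil => simp at h
  | cons c u ih =>
    rw [dec]
    split_ifs with hc
    · simp at hc h
      simpa using ih (by simpa [hc] using h)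
    · have := length_dec_le (f := f) u ([] ++ [c])
      simp at this ⊢; omega

lemma coding_dec (f : α → ℤ) : Coding f (dec f []) :=
  ⟨fun u v hu _ => dec_append u v [] (by simpa using hu) (Or.inl rfl), fun u hu h => by
    have := flatten_dec u [] (by simpa using hu) (Or.inl rfl)
    rw [h] at this; simpa using this.symm⟩

/-- Makes the code of a reversed word the reverse of its code, so that the left and right systems
still concern the same three words. -/
lemma Coding.rev (hD : Coding f D) : Coding f fun u => (D u.reverse).reverse :=
  ⟨fun u v hu hv => by
    simp only [reverse_append]
    rw [hD.append _ _ (by simpa using hv) (by simpa using hu), reverse_append],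
  fun u hu h => by
    have := hD.eq_nil u.reverse (by simpa using hu) (by simpa using h)
    simpa using this⟩

/-- In a system from the left together with one from the right, the two longer words are powers
of a common word. -/
theorem LSys.exists_pw : ∀ (n : ℕ) {α : Type u} {U V U' V' : List (Option α)} {x y z : List α},
    z.length ≤ n → LSys U V x y z → LSys U' V' x.reverse y.reverse z.reverse →
    ∃ (r : List α) (j k : ℕ), y = pw r j ∧ z = pw r k := by
  intro n
  induction n with
  | zero => intro α U V U' V' x y z h L _; have := L.lyz; omega
  | succ n ih =>
    intro α U V U' V' x y z h L R
    rcases L.exists_weight with ⟨c, hc⟩ | ⟨f, hx, hy, hf⟩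
    · have hz := eq_replicate_iff.2 ⟨rfl, hc⟩
      have hy := eq_replicate_iff.2 ⟨rfl, fun b hb => hc b (L.yz.subset hb)⟩
      refine ⟨[c], y.length, z.length, ?_, ?_⟩ <;> simpa [pw]
    · have hz := L.weight_eq_zero R hx hy rfl
      rw [hz] at hx hy
      have hD := coding_dec f
      have L' := L.recode hD hx hy hz
      have R' := R.recode hD.rev (by simpa using hx) (by simpa using hy) (by simpa using hz)
      simp only [reverse_reverse] at R'
      obtain ⟨r, j, k, h1, h2⟩ := ih (by have := length_dec_lt hf; omega) L' R'
      have e : ∀ {t}, wt f t = 0 → (dec f [] t).flatten = t := fun ht =>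
        flatten_dec _ [] (by simpa using ht) (Or.inl rfl)
      exact ⟨r.flatten, j, k, by rw [← e hy, h1, flatten_pw], by rw [← e hz, h2, flatten_pw]⟩

end Recoding

/-! ### From four solutions to systems at both ends -/

section Balanced

variable {α : Type u} {U V U₀ V₀ : List (Option α)} {x y z : List α}

/-- An equation solved by the empty word and three further words of increasing lengths that does
not split into shorter equations with these solutions. -/
structure Balanced (U V : List (Option α)) (x y z : List α) : Prop where
  sole : sub [] U = sub [] V
  solx : sub x U = sub x V
  soly : sub y U = sub y V
  solz : sub z U = sub z V
  ne : x ≠ []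
  lxy : x.length < y.length
  lyz : y.length < z.length
  two : 2 ≤ U.length
  cX : cX U = cX V
  lead : ∀ m, 0 < m → m < U.length → OneVar.cX (U.take m) < OneVar.cX (V.take m)

lemma cX_take_add_drop (W : List (Option α)) (m : ℕ) :
    cX (W.take m) + cX (W.drop m) = cX W := by
  rw [← cX_append, take_append_drop]

lemma At.unique {W A B : List (Option α)} (hA : At W A none) (hB : At W B none)
    (h : cX A = cX B) : A = B := by
  rcases hA.trichotomy hB with h' | h' | h'
  · exact h'.1
  · have := h'.cX_lt; omega
  · have := h'.cX_lt; omega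

namespace Balanced

lemma length_eq (B : Balanced U V x y z) : U.length = V.length := by
  rw [length_side, length_side V, B.sole, B.cX]

lemma reverse (B : Balanced U V x y z) :
    Balanced V.reverse U.reverse x.reverse y.reverse z.reverse := by
  have h0 : ∀ W : List (Option α), sub [] W.reverse = (sub [] W).reverse := fun W => by
    simpa using sub_reverse [] W
  refine ⟨by rw [h0, h0, B.sole], by rw [sub_reverse, sub_reverse, B.solx],
    by rw [sub_reverse, sub_reverse, B.soly], by rw [sub_reverse, sub_reverse, B.solz],
    by simpa using B.ne, by simpa using B.lxy, by simpa using B.lyz,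
    by simpa [← B.length_eq] using B.two, by rw [cX_reverse, cX_reverse, B.cX], ?_⟩
  intro m h1 h2
  rw [length_reverse, ← B.length_eq] at h2
  rw [take_reverse, take_reverse, cX_reverse, cX_reverse, ← B.length_eq]
  have h3 := B.lead (U.length - m) (by omega) (by omega)
  have h4 := cX_take_add_drop U (U.length - m)
  have h5 := cX_take_add_drop V (U.length - m)
  have h6 := B.cX
  omega

lemma start (B : Balanced U V x y z) : (∃ V', V = none :: V') ∧
    ∃ u W, u ≠ [] ∧ U = u.map some ++ none :: W := by
  have h1 := B.lead 1 one_pos B.two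
  have hV : ∃ V', V = none :: V' := by
    match V with
    | [] => simp at h1
    | some c :: V => simp at h1
    | none :: V => exact ⟨V, rfl⟩
  refine ⟨hV, ?_⟩
  obtain ⟨V', rfl⟩ := hV
  have h2 := B.cX
  obtain ⟨u, rfl | ⟨W, rfl⟩⟩ := exists_leading_letters U
  · simp at h2
  · refine ⟨u, W, ?_, rfl⟩
    rintro rfl
    simp at h1

lemma end_var (B : Balanced U V x y z) : ∃ U₁, U = U₁ ++ [none] := by
  obtain ⟨W, hW⟩ := B.reverse.start.1
  exact ⟨W.reverse, by rw [← reverse_reverse U, hW]; simp⟩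

lemma pre_append {u : List α} {W V' : List (Option α)} {t : List α}
    (h : sub t (u.map some ++ none :: W) = sub t (none :: V')) : t <+: u ++ t := by
  simp only [sub_append, sub_map_some, sub_none] at h
  refine prefix_of_prefix_length_le (prefix_append t (sub t V')) ?_ (by simp)
  rw [← h, ← append_assoc]
  exact prefix_append _ _

/-- Such words are prefixes of u u u …, hence comparable. -/
lemma chain {u : List α} (hu : u ≠ []) : ∀ (n : ℕ) {s t : List α}, t.length ≤ n →
    s <+: u ++ s → t <+: u ++ t → s.length ≤ t.length → s <+: t := by
  have hu' := length_pos_iff.2 hu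
  intro n
  induction n with
  | zero =>
    intro s t h _ _ hl
    rw [eq_nil_of_length_eq_zero (l := s) (by omega)]
    exact nil_prefix
  | succ n ih =>
    intro s t h hs ht hl
    rcases le_total t.length u.length with h1 | h1
    · exact prefix_of_prefix_length_le (prefix_of_prefix_length_le hs (prefix_append _ _)
        (hl.trans h1)) (prefix_of_prefix_length_le ht (prefix_append _ _) h1) hl
    · obtain ⟨t', rfl⟩ := prefix_of_prefix_length_le (prefix_append u t) ht h1
      rcases le_total s.length u.length with h2 | h2
      · exact (prefix_of_prefix_length_le hs (prefix_append _ _) h2).trans (prefix_append _ _)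
      · obtain ⟨s', rfl⟩ := prefix_of_prefix_length_le (prefix_append u s) hs h2
        rw [prefix_append_right_inj] at hs ht ⊢
        exact ih (by simp at h; omega) hs ht (by simpa using hl)

lemma chains (B : Balanced U V x y z) : x <+: y ∧ y <+: z := by
  obtain ⟨⟨V', rfl⟩, u, W, hu, rfl⟩ := B.start
  exact ⟨chain hu _ le_rfl (pre_append B.solx) (pre_append B.soly) B.lxy.le,
    chain hu _ le_rfl (pre_append B.soly) (pre_append B.solz) B.lyz.le⟩

lemma suffix_chains (B : Balanced U V x y z) : x <:+ y ∧ y <:+ z :=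
  ⟨reverse_prefix.1 B.reverse.chains.1, reverse_prefix.1 B.reverse.chains.2⟩

lemma last_var {U₁ A : List (Option α)} (hA : At (U₁ ++ [none]) A none)
    (h : OneVar.cX (U₁ ++ [none]) ≤ OneVar.cX A + 1) : A = U₁ :=
  hA.unique prefix_rfl (by have := hA.cX_lt; simp at this h; omega)

/-- Cutting both sides where the lead of V first fails the gap condition leaves a system in which
the gap holds throughout. -/
theorem lsys (B : Balanced U V x y z) {u : List α} {W : List (Option α)}
    (hU : U = u.map some ++ none :: W) (hu : 2 * x.length ≤ u.length) :
    ∃ U₁ V₁, LSys U₁ V₁ x y z := by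
  obtain ⟨U₁, hU₁⟩ := B.end_var
  have hc : cC U = cC V := by rw [cC, B.sole]
  have hcX := B.cX
  have hAU₁ : At U U₁ none := by rw [hU₁]; exact prefix_rfl
  -- A marks the first variable of U violating the gap; the last variable does so vacuously.
  obtain ⟨A, ⟨hA, hbad⟩, hmin⟩ := exists_shortest
    (P := fun A => At U A none ∧ ∀ C, At V C none → OneVar.cX C = OneVar.cX A + 1 →
      cC A ≤ cC C + x.length) ⟨U₁, hAU₁, fun C hC h => by
        have := hC.cX_lt
        rw [← hcX, hU₁] at this
        simp at this; omega⟩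
  have notbad : ∀ C, At U C none → OneVar.cX C < OneVar.cX A → ∃ D, At V D none ∧
      OneVar.cX D = OneVar.cX C + 1 ∧ cC D + x.length < cC C ∧ cC C ≤ cC A := by
    intro C hC hlt
    have hCA : At A C none := by
      rcases hC.trichotomy hA with h | h | h
      · rw [h.1] at hlt; omega
      · exact h
      · have := h.cX_lt; omega
    by_contra hcon
    push Not at hcon
    have := hmin C ⟨hC, fun D hD h => by
      by_contra hlt'
      have := hcon D hD h (by omega)
      have := cC_mono hCA.pre
      omega⟩
    have := hCA.length_le
    simp at this; omega
  have hAX := hA.cX_lt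
  have hlead : ∀ C, At V C none → OneVar.cX C = OneVar.cX A + 1 → cC C < cC A := by
    intro C hC h
    have hle : C.length ≤ A.length := by
      by_contra hlt
      push Not at hlt
      have h1 := B.lead (A.length + 1) (by omega) (by
        have := hC.length_le
        rw [B.length_eq]
        simp at this; omega)
      have h2 : A ++ [none] = U.take (A.length + 1) := by
        have := prefix_iff_eq_take.1 hA
        simpa using this
      have h3 : V.take (A.length + 1) <+: C :=
        prefix_of_prefix_length_le (take_prefix _ _) hC.pre (by simp; omega)
      have h4 := cX_mono h3
      rw [← h2] at h1
      simp at h1; omega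
    rw [length_side, length_side A] at hle
    simp only [cC]; omega
  obtain ⟨V₁, hV₁, hV₁X, hV₁A, hAV₁⟩ : ∃ V₁, V₁ <+: V ∧ OneVar.cX V₁ = OneVar.cX A + 1 ∧
      cC V₁ ≤ cC A ∧ cC A ≤ cC V₁ + x.length := by
    rcases lt_or_ge (OneVar.cX A + 1) (OneVar.cX V) with hlt | hge
    · obtain ⟨C, hC, h⟩ := exists_at_none hlt
      exact ⟨C, hC.pre, h, (hlead C hC h).le, hbad C hC h⟩
    · have : A = U₁ := last_var (hU₁ ▸ hA) (by rw [← hU₁]; omega)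
      have h1 : cC A = cC U := by rw [this, hU₁]; simp [cC]
      exact ⟨V, prefix_rfl, by omega, by omega, by omega⟩
  obtain ⟨B₀, hB₀, hB₀X⟩ := exists_at_none (W := V) (j := OneVar.cX A) (by omega)
  obtain ⟨R, hR⟩ : B₀ ++ [none] <+: V₁ := by
    rcases lt_or_ge B₀.length V₁.length with h | h
    · exact hB₀.of_lt hV₁ h
    · have := cX_mono (prefix_of_prefix_length_le hV₁ hB₀.pre h)
      omega
  obtain ⟨g, rfl⟩ : ∃ g : List α, R = g.map some :=
    ⟨_, eq_map_of_cX_eq_zero (by rw [← hR] at hV₁X; simp at hV₁X; omega)⟩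
  have huA : u.length ≤ cC A := by
    have h1 : At (u.map some ++ none :: W) A none := hU ▸ hA
    rcases at_append_map h1 with rfl | ⟨A', rfl, -⟩ <;> simp [cC]
  -- The cut V is short by this many letters. All three solutions end with x, so the missing piece
  -- is the same suffix e of x for each.
  obtain ⟨e, he, hel⟩ : ∃ e : List α, e <:+ x ∧ e.length = cC A - cC V₁ :=
    ⟨x.drop (x.length - (cC A - cC V₁)), drop_suffix _ _, by simp; omega⟩
  have hsol : ∀ t, x <:+ t → sub t U = sub t V →
      sub t (A ++ [none]) = sub t (V₁ ++ e.map some) := by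
    intro t hxt hs
    have h1 : sub t V₁ <+: sub t (A ++ [none]) := by
      refine prefix_of_prefix_length_le (hs ▸ sub_prefix t hV₁) (sub_prefix t hA) ?_
      rw [length_sub, length_sub t (_ ++ _), hV₁X]
      simpa using hV₁A
    obtain ⟨d, hd⟩ := h1
    have hdl : d.length = cC A - cC V₁ := by
      have := congrArg length hd
      rw [length_append, length_sub, length_sub t (_ ++ _), hV₁X] at this
      simp [cC] at this ⊢; omega
    have h2 : e <:+ sub t (A ++ [none]) := by
      simp only [sub_append, sub_none, sub_nil, append_nil]
      exact (he.trans hxt).trans (suffix_append _ _)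
    have h3 : d <:+ sub t (A ++ [none]) := hd ▸ suffix_append _ _
    have h4 : e = d :=
      (suffix_of_suffix_length_le h2 h3 (by omega)).eq_of_length (by omega)
    rw [← hd, sub_append, sub_map_some, h4]
  have hgl : g.length + e.length + cC B₀ = cC A := by
    have : cC V₁ = cC B₀ + g.length := by rw [← hR]; simp [cC]
    omega
  -- From the gap at the previous variable of U or, if there is none, from the length of u.
  have hxg : x.length ≤ g.length + e.length := by
    rcases Nat.eq_zero_or_pos (OneVar.cX A) with h0 | h0
    · have h1 : B₀ = [] := by
        obtain ⟨V', hV'⟩ := B.start.1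
        exact hB₀.unique (by rw [hV']; exact at_nil _ _) (by simp; omega)
      rw [h1] at hgl
      simp [cC] at hgl huA; omega
    · obtain ⟨C, hC, hCX⟩ := exists_at_none (W := U) (j := OneVar.cX A - 1) (by omega)
      obtain ⟨D, hD, hDX, h1, h2⟩ := notbad C hC (by omega)
      rw [hD.unique hB₀ (by omega)] at h1
      omega
  have hsx := hsol x suffix_rfl B.solx
  obtain ⟨g₀, hg₀⟩ : x <:+ g ++ e := by
    have h1 : x <:+ sub x (A ++ [none]) := by
      simp only [sub_append, sub_none, sub_nil, append_nil]
      exact suffix_append _ _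
    have h2 : g ++ e <:+ sub x (A ++ [none]) := by
      rw [hsx, ← hR]
      simp only [sub_append, sub_map_some, append_assoc]
      rw [← append_assoc]
      exact suffix_append _ _
    exact suffix_of_suffix_length_le h1 h2 (by simpa using hxg)
  have hg₀l : g₀.length + x.length = g.length + e.length := by
    simpa using congrArg length hg₀
  have hxx := B.suffix_chains
  have hchain := B.chains
  have hg₀g : g₀ <+: g := by
    refine prefix_of_prefix_length_le (l₃ := g ++ e) ?_ (prefix_append _ _) (by omega)
    rw [← hg₀]; exact prefix_append _ _
  have hp1 : sub [] (B₀ ++ none :: g₀.map some) <+: sub [] U := by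
    rw [B.sole]
    refine IsPrefix.trans ?_ (sub_prefix [] hV₁)
    rw [← hR]
    simpa [prefix_append_right_inj] using hg₀g
  refine ⟨A ++ [none], V₁ ++ e.map some, hsx, hsol y hxx.1 B.soly,
    hsol z (hxx.1.trans hxx.2) B.solz, B.ne, hchain.1, B.lxy, hchain.2, B.lyz, ⟨A, rfl⟩,
    ⟨B₀ ++ none :: g₀.map some, ?_, ?_, ?_⟩, ?_, ?_⟩
  · rw [← hR]
    simp only [append_assoc, cons_append, ← map_append, hg₀, nil_append]
  · have hxU : x <+: sub [] U := by
      have hUx : sub x U = u ++ (x ++ sub x W) := by rw [hU]; simp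
      obtain ⟨V', hV'⟩ := B.start.1
      have h1 : x <+: sub x U := by rw [B.solx, hV']; exact prefix_append _ _
      have h2 : x <+: u :=
        prefix_of_prefix_length_le h1 (hUx ▸ prefix_append _ _) (by omega)
      refine h2.trans ?_
      rw [hU]; simp
    -- The constants up to g₀ number `cC A` − |x|, which must be at least |x|: hence the factor 2 in
    -- `hu`.
    refine prefix_of_prefix_length_le hxU hp1 ?_
    simp [cC] at hgl huA ⊢
    omega
  · refine prefix_of_prefix_length_le hp1 (sub_prefix [] hA) ?_
    simp [cC] at hgl ⊢
    omega
  · obtain ⟨V', hV'⟩ := B.start.1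
    refine IsPrefix.trans ?_ (prefix_append _ _)
    refine prefix_of_prefix_length_le (l₃ := V) (by rw [hV']; simp) hV₁ ?_
    rw [← hR]; simp; omega
  · intro C D hC hD hCD
    have hD' := hD.none_of_append_map
    have h1 := hD'.cX_lt
    obtain ⟨D', hD'', h2, h3, -⟩ := notbad C (hC.mono hA) (by omega)
    rw [hD''.unique (hD'.mono hV₁) (by omega)] at h3
    rw [length_sub, length_sub x C, hCD]
    simp only [cC] at h3
    nlinarith

end Balanced

lemma infinite_of_pw {ρ r : List α} (hρ : ρ ≠ []) {a b : ℕ} (ha : 1 ≤ a) (hab : a < b)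
    (h1 : sub (pw ρ a ++ r) U₀ = sub (pw ρ a ++ r) V₀)
    (h2 : sub (pw ρ b ++ r) U₀ = sub (pw ρ b ++ r) V₀) :
    {t | sub t U₀ = sub t V₀}.Infinite := by
  refine Set.infinite_of_injective_forall_mem (f := fun n : ℕ => pw ρ n ++ r) ?_
    (fun n => pw_solutions hρ ha hab h1 h2 n)
  intro m n h
  have := congrArg length h
  simp at this
  rcases this with h | h
  · exact h
  · exact absurd h hρ

lemma infinite_reverse (h : {t | sub t U₀.reverse = sub t V₀.reverse}.Infinite) :
    {t | sub t U₀ = sub t V₀}.Infinite := by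
  intro hfin
  refine h ((hfin.image List.reverse).subset fun t ht => ⟨t.reverse, ?_, reverse_reverse t⟩)
  have : sub t U₀.reverse = sub t V₀.reverse := ht
  rw [← reverse_reverse t, sub_reverse, sub_reverse] at this
  exact reverse_injective this

namespace Balanced

/-- Write y = k x. If |k| ≤ |x| then x = k r and y = k k r, exponents 1 and 2. -/
lemma infinite_or_long (B : Balanced U V x y z) (hx : sub x U₀ = sub x V₀)
    (hy : sub y U₀ = sub y V₀) :
    {t | sub t U₀ = sub t V₀}.Infinite ∨ 2 * x.length ≤ y.length := by
  obtain ⟨k, rfl⟩ := B.suffix_chains.1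
  rcases le_total k.length x.length with h | h
  · left
    obtain ⟨r, rfl⟩ : k <+: x := prefix_of_prefix_length_le (prefix_append k x) B.chains.1 h
    have hk : k ≠ [] := by rintro rfl; have := B.lxy; simp at this
    refine infinite_of_pw (ρ := k) (r := r) hk le_rfl one_lt_two ?_ ?_
    · simpa using hx
    · simpa [pw] using hy
  · right; simp; omega

/-- If u is shorter than y, write y = u y' and z = k y. As z is a prefix of u z, u and k commute, so
y and z are powers of one word followed by y'. -/
lemma infinite_or_start (B : Balanced U V x y z) {u : List α} {W : List (Option α)}
    (hU : U = u.map some ++ none :: W) (hy : sub y U₀ = sub y V₀) (hz : sub z U₀ = sub z V₀) :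
    {t | sub t U₀ = sub t V₀}.Infinite ∨ y.length ≤ u.length := by
  rcases le_total y.length u.length with h | h
  · exact Or.inr h
  left
  obtain ⟨⟨V', rfl⟩, u', W', hu, hU'⟩ := B.start
  have huu : u ≠ [] := by
    rintro rfl
    have := B.lead 1 one_pos B.two
    rw [hU] at this
    simp at this
  have hyu : y <+: u ++ y := pre_append (hU ▸ B.soly)
  have hzu : z <+: u ++ z := pre_append (hU ▸ B.solz)
  obtain ⟨y', rfl⟩ : u <+: y := prefix_of_prefix_length_le (prefix_append u y) hyu h
  obtain ⟨k, rfl⟩ := B.suffix_chains.2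
  have huz : u ++ k <+: k ++ (u ++ y') := by
    refine prefix_of_prefix_length_le ((prefix_append_right_inj u).2 (prefix_append k (u ++ y')))
      hzu (by simp; omega)
  have hcomm : u ++ k = k ++ u := by
    rw [← append_assoc] at huz
    exact (prefix_of_prefix_length_le huz (prefix_append _ _) (by simp; omega)).eq_of_length
      (by simp; omega)
  obtain ⟨r, i, j, rfl, rfl⟩ := exists_pw_of_commute _ u k le_rfl hcomm
  have hr : r ≠ [] := by rintro rfl; simp [pw] at huu
  have hi : i ≠ 0 := by rintro rfl; simp at huu
  have hj : j ≠ 0 := by rintro rfl; have := B.lyz; simp at this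
  refine infinite_of_pw (ρ := r) (r := y') (a := i) (b := j + i) hr (by omega) (by omega) hy ?_
  rw [pw_add, append_assoc]; exact hz

theorem infinite (B : Balanced U V x y z) (hx : sub x U₀ = sub x V₀) (hy : sub y U₀ = sub y V₀)
    (hz : sub z U₀ = sub z V₀) : {t | sub t U₀ = sub t V₀}.Infinite := by
  have rev : ∀ {t}, sub t U₀ = sub t V₀ →
      sub t.reverse U₀.reverse = sub t.reverse V₀.reverse := by
    intro t h; rw [sub_reverse, sub_reverse, h]
  rcases B.infinite_or_long hx hy with h | h1
  · exact h
  obtain ⟨-, u, W, -, hU⟩ := B.start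
  obtain ⟨-, v, W', -, hV⟩ := B.reverse.start
  rcases B.infinite_or_start hU hy hz with h | h2
  · exact h
  rcases B.reverse.infinite_or_start hV (rev hy) (rev hz) with h | h3
  · exact infinite_reverse h
  obtain ⟨U₁, V₁, L⟩ := B.lsys hU (by omega)
  obtain ⟨U₂, V₂, R⟩ := B.reverse.lsys hV (by simp at h3 ⊢; omega)
  obtain ⟨r, j, k, h4, h5⟩ := LSys.exists_pw _ le_rfl L R
  have hl := B.lxy
  have hl' := B.lyz
  rw [h5, h4, length_pw, length_pw] at hl'
  rw [h4, length_pw] at hl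
  refine infinite_of_pw (ρ := r) (r := []) (a := j) (b := k) ?_ ?_ (lt_of_mul_lt_mul_right' hl') ?_ ?_
  · rintro rfl; simp at hl
  · rcases Nat.eq_zero_or_pos j with rfl | h
    · simp at hl
    · exact h
  · simpa [← h4] using hy
  · simpa [← h5] using hz

end Balanced

/-- If the empty word and three words of increasing lengths solve some nontrivial equation, then
they solve a balanced one. -/
theorem exists_balanced (hne : U₀ ≠ V₀) (he : sub [] U₀ = sub [] V₀)
    (hx : sub x U₀ = sub x V₀) (hy : sub y U₀ = sub y V₀) (hz : sub z U₀ = sub z V₀)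
    (hx0 : x ≠ []) (hxy : x.length < y.length) (hyz : y.length < z.length) :
    ∃ U V, Balanced U V x y z := by
  obtain ⟨U, ⟨V, hUV, h0, h1, h2, h3⟩, hmin⟩ := exists_shortest
    (P := fun U : List (Option α) => ∃ V, U ≠ V ∧ sub [] U = sub [] V ∧ sub x U = sub x V ∧
      sub y U = sub y V ∧ sub z U = sub z V) ⟨U₀, V₀, hne, he, hx, hy, hz⟩
  have hX : cX U = cX V := (counts_of_length hxy (by rw [h1]) (by rw [h2])).1
  have hl : U.length = V.length := by rw [length_side, length_side V, h0, hX]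
  -- Equal counts at a cut split the equation into two shorter ones with the same four solutions; by
  -- minimality both are trivial.
  have hneq : ∀ m, 0 < m → m < U.length → cX (U.take m) ≠ cX (V.take m) := by
    intro m hm1 hm2 hm
    have hlt : (U.take m).length = (V.take m).length := by simp [hl]
    have hc : (sub [] (U.take m)).length = (sub [] (V.take m)).length := by
      rw [length_side, length_side (V.take m)] at hlt; omega
    have split : ∀ t, sub t U = sub t V → sub t (U.take m) = sub t (V.take m) ∧
        sub t (U.drop m) = sub t (V.drop m) := by
      intro t ht
      refine append_inj ?_ (by rw [length_sub, length_sub t (V.take m), hm, hc])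
      rw [← sub_append, ← sub_append, take_append_drop, take_append_drop, ht]
    have e1 : U.take m = V.take m := by
      by_contra hcon
      have := hmin _ ⟨_, hcon, (split _ h0).1, (split _ h1).1, (split _ h2).1, (split _ h3).1⟩
      simp at this; omega
    have e2 : U.drop m = V.drop m := by
      by_contra hcon
      have := hmin _ ⟨_, hcon, (split _ h0).2, (split _ h1).2, (split _ h2).2, (split _ h3).2⟩
      simp at this; omega
    exact hUV (by rw [← take_append_drop m U, e1, e2, take_append_drop])
  have htwo : 2 ≤ U.length := by
    by_contra hlt
    match U, V, hl with
    | [], [], _ => exact hUV rfl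
    | [none], [none], _ => exact hUV rfl
    | [none], [some d], _ => simp at hX
    | [some c], [none], _ => simp at hX
    | [some c], [some d], _ => simp at h0; exact hUV (by rw [h0])
    | _ :: _ :: _, _, _ => simp at hlt
  have step : ∀ (W : List (Option α)) m, cX (W.take m) ≤ cX (W.take (m + 1)) ∧
      cX (W.take (m + 1)) ≤ cX (W.take m) + 1 := by
    intro W
    induction W using side_induction with
    | nil => simp
    | none W ih => intro m; cases m <;> simp [ih]
    | some c W ih => intro m; cases m <;> simp [ih]
  -- The difference of the counts changes by at most one per symbol and never vanishes, so it keeps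
  -- its sign.
  have lead : ∀ A B : List (Option α), cX (A.take 1) < cX (B.take 1) →
      (∀ m, 0 < m → m < U.length → cX (A.take m) ≠ cX (B.take m)) →
      ∀ m, 0 < m → m < U.length → cX (A.take m) < cX (B.take m) := by
    intro A B hAB hne m
    induction m with
    | zero => intro h; exact absurd h (lt_irrefl _)
    | succ m ih =>
      intro _ hm
      rcases Nat.eq_zero_or_pos m with rfl | hm0
      · exact hAB
      · have := ih hm0 (by omega)
        have := step A m
        have := step B m
        have := hne (m + 1) (by omega) hm
        omega
  rcases lt_or_gt_of_ne (hneq 1 one_pos htwo) with h | h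
  · exact ⟨U, V, h0, h1, h2, h3, hx0, hxy, hyz, htwo, hX, lead U V h hneq⟩
  · exact ⟨V, U, h0.symm, h1.symm, h2.symm, h3.symm, hx0, hxy, hyz, hl ▸ htwo, hX.symm,
      hl ▸ lead V U h fun m h h' => (hneq m h h').symm⟩

end Balanced

/-! ### The upper bound -/

section AtMostThree

variable {α : Type u} {U V : List (Option α)}

lemma prefix_of_head {V : List (Option α)} {c : α} {U : List (Option α)} {s t : List α}
    (hs : sub s (some c :: U) = sub s (none :: V)) (ht : sub t (some c :: U) = sub t (none :: V))
    (hl : s.length ≤ t.length) : s <+: t := by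
  obtain ⟨u, h | ⟨W, h⟩⟩ := exists_leading_letters (some c :: U)
  · rw [h, sub_map_some] at hs ht
    exact prefix_of_prefix_length_le (l₃ := u) (by rw [hs]; exact prefix_append _ _)
      (by rw [ht]; exact prefix_append _ _) hl
  · have hu : u ≠ [] := by rintro rfl; simp at h
    rw [h] at hs ht
    exact Balanced.chain hu _ le_rfl (Balanced.pre_append hs) (Balanced.pre_append ht) hl

/-- The solutions of a nontrivial equation form a chain of prefixes. -/
lemma solutions_chain {s t : List α} (hl : s.length ≤ t.length) : ∀ {U V : List (Option α)},
    U ≠ V → sub s U = sub s V → sub t U = sub t V → s <+: t := by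
  have nil_of : ∀ {W : List (Option α)} {o}, sub s (o :: W) = [] → s <+: t := by
    intro W o h
    cases o with
    | none => rw [sub_none, append_eq_nil_iff] at h; rw [h.1]; exact nil_prefix
    | some c => simp at h
  intro U
  induction U with
  | nil =>
    intro V hne hs _
    match V with
    | [] => exact absurd rfl hne
    | o :: V => exact nil_of hs.symm
  | cons o U ih =>
    intro V hne hs ht
    match o, V with
    | _, [] => exact nil_of hs
    | none, none :: V =>
      exact ih (fun h => hne (by rw [h])) (by simpa using hs) (by simpa using ht)
    | some c, none :: V => exact prefix_of_head hs ht hl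
    | none, some c :: V => exact prefix_of_head hs.symm ht.symm hl
    | some c, some d :: V =>
      simp only [sub_some, cons.injEq] at hs ht
      exact ih (fun h => hne (by rw [h, hs.1])) hs.2 ht.2

/-- Replacing the variable `X` by `r X`. -/
def mulLeft (r : List α) : List (Option α) → List (Option α)
  | [] => []
  | none :: W => r.map some ++ none :: mulLeft r W
  | some c :: W => some c :: mulLeft r W

lemma sub_mulLeft (r t : List α) (W) : sub t (mulLeft r W) = sub (r ++ t) W := by
  induction W using side_induction <;> simp_all [mulLeft]

lemma infinite_words (c : α) : (Set.univ : Set (List α)).Infinite :=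
  haveI : Nonempty α := ⟨c⟩
  Set.infinite_univ

theorem encard_solutions_le (hfin : {t | sub t U = sub t V}.Finite) :
    {t | sub t U = sub t V}.encard ≤ 3 := by
  by_contra hcard
  push Not at hcard
  set S := {t | sub t U = sub t V} with hS
  -- A trivial equation is solved by every word: one word over the empty alphabet, infinitely many
  -- otherwise.
  have hne : U ≠ V := by
    rintro rfl
    have hS' : S = Set.univ := by simp [hS]
    rcases isEmpty_or_nonempty α with h | ⟨⟨c⟩⟩
    · have : S.Subsingleton := fun s _ t _ => Subsingleton.elim s t
      have h1 := Set.encard_le_one_iff_subsingleton.2 this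
      exact absurd (hcard.trans_le h1) (by norm_num)
    · exact infinite_words c (hS' ▸ hfin)
  have hchain : ∀ s ∈ S, ∀ t ∈ S, s.length ≤ t.length → s <+: t :=
    fun s hs t ht hl => solutions_chain hl hne hs ht
  have hinj : Set.InjOn List.length S := fun s hs t ht h =>
    (hchain s hs t ht h.le).eq_of_length h
  have hfin' : (List.length '' S).Finite := hfin.image _
  have hF : 4 ≤ hfin'.toFinset.card := by
    rw [← hinj.encard_image, hfin'.encard_eq_coe_toFinset_card] at hcard
    have : 3 < hfin'.toFinset.card := by exact_mod_cast hcard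
    exact this
  have hmem : ∀ i : Fin 4, ∃ t ∈ S, t.length = hfin'.toFinset.orderEmbOfCardLe hF i := fun i => by
    have := Finset.orderEmbOfCardLe_mem hfin'.toFinset hF i
    rwa [hfin'.mem_toFinset] at this
  choose t ht hlen using hmem
  have hlt : ∀ i j : Fin 4, i < j → (t i).length < (t j).length := fun i j h => by
    rw [hlen, hlen]; simpa using h
  have hpre : ∀ i, t 0 <+: t i := fun i => hchain _ (ht 0) _ (ht i) (by
    rcases eq_or_ne i 0 with rfl | h
    · exact le_rfl
    · exact (hlt 0 i (Fin.pos_iff_ne_zero.2 h)).le)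
  -- Removing the shortest solution from the left leaves the empty word and three nonempty words of
  -- increasing lengths.
  choose y hy using hpre
  have hsol : ∀ i, sub (y i) (mulLeft (t 0) U) = sub (y i) (mulLeft (t 0) V) := fun i => by
    rw [sub_mulLeft, sub_mulLeft, hy]; exact ht i
  have hylt : ∀ i j : Fin 4, i < j → (y i).length < (y j).length := fun i j h => by
    have := hlt i j h
    rw [← hy i, ← hy j] at this
    simpa using this
  have hy0 : y 0 = [] := by simpa using hy 0
  have hinf : {s | sub s (mulLeft (t 0) U) = sub s (mulLeft (t 0) V)}.Infinite := by
    have hne1 : y 1 ≠ [] := by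
      intro h
      have := hylt 0 1 (by decide)
      simp [h] at this
    by_cases heq : mulLeft (t 0) U = mulLeft (t 0) V
    · simp only [heq, Set.ofPred_true]
      obtain ⟨c, _, -⟩ := exists_cons_of_ne_nil hne1
      exact infinite_words c
    · obtain ⟨U', V', B⟩ := exists_balanced heq (hy0 ▸ hsol 0) (hsol 1) (hsol 2) (hsol 3) hne1
        (hylt 1 2 (by decide)) (hylt 2 3 (by decide))
      exact B.infinite (hsol 1) (hsol 2) (hsol 3)
  refine (hinf.image (f := (t 0 ++ ·)) (append_right_injective _).injOn).mono ?_ hfin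
  rintro _ ⟨s, hs, rfl⟩
  have : sub s (mulLeft (t 0) U) = sub s (mulLeft (t 0) V) := hs
  rwa [sub_mulLeft, sub_mulLeft] at this

end AtMostThree

/-! ### An equation with exactly three solutions -/

section ExactlyThree

variable {α : Type u}

/-- The left side of an equation with exactly three solutions. -/
def tripleL (a b : α) : List (Option α) :=
  ([a, b, a, a, b, b, a, b, a].map some ++ none :: [b, a, b, a, a, b, b].map some) ++
    [none, some a, none, some b, none]

/-- The right side of an equation with exactly three solutions. -/
def tripleR (a b : α) : List (Option α) :=
  [none, some a, none, some b, none] ++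
    ([a, a, b, b, a, b, a].map some ++ none :: [b, a, b, a, a, b, b, a, b].map some)

/-- A longer solution is u y for the initial block u of the left side. Cancelling u gives u y b = y
a u by lengths, but u ends in a. -/
lemma triple_long {a b : α} (hab : a ≠ b) {t : List α}
    (h : sub t (tripleL a b) = sub t (tripleR a b)) : t.length < 9 := by
  by_contra hlt
  push Not at hlt
  set u := [a, b, a, a, b, b, a, b, a] with hu
  have hul : u.length = 9 := rfl
  have hL : sub t (tripleL a b) = u ++ ((t ++ [b]) ++
      ([a, b, a, a, b, b] ++ (t ++ a :: (t ++ b :: t)))) := by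
    simp [tripleL, hu]
  have hR : sub t (tripleR a b) =
      t ++ a :: (t ++ (b :: (t ++ ([a, a, b, b, a, b, a] ++
        (t ++ [b, a, b, a, a, b, b, a, b]))))) := by
    simp [tripleR]
  rw [hL, hR] at h
  have hut : u <+: t := prefix_of_prefix_length_le (prefix_append u _) (h ▸ prefix_append t _)
    (by omega)
  obtain ⟨y, rfl⟩ := hut
  replace h := append_cancel_left (h.trans (append_assoc u y _))
  have h1 : (u ++ y ++ [b]) ++ ([a, b, a, a, b, b] ++ (u ++ y ++ a :: (u ++ y ++ b :: (u ++ y)))) =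
      (y ++ [a] ++ u) ++ (y ++ (b :: (u ++ y ++ ([a, a, b, b, a, b, a] ++
        (u ++ y ++ [b, a, b, a, a, b, b, a, b]))))) := by
    rw [h]; simp
  have h2 := (append_inj h1 (by simp; omega)).1
  have h3 : (u ++ y) ++ [b] = (y ++ [a] ++ [a, b, a, a, b, b, a, b]) ++ [a] := by
    rw [h2]; simp [hu]
  have h4 := (append_inj' h3 rfl).2
  exact hab (by simpa using h4.symm)

lemma triple_solutions {a b : α} (hab : a ≠ b) :
    {t | sub t (tripleL a b) = sub t (tripleR a b)} =
      {[], [a, b], [a, b, a, a, b, b, a, b]} := by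
  ext t
  simp only [Set.mem_ofPred_eq, Set.mem_insert_iff, Set.mem_singleton_iff]
  constructor
  · intro h
    have hl := triple_long hab h
    have ht : t <+: [a, b, a, a, b, b, a, b, a] := by
      have h1 : sub t (tripleL a b) = [a, b, a, a, b, b, a, b, a] ++
          (t ++ sub t ([b, a, b, a, a, b, b].map some ++ [none, some a, none, some b, none])) := by
        simp [tripleL]
      have h2 : t <+: sub t (tripleR a b) := prefix_append _ _
      rw [← h, h1] at h2
      exact prefix_of_prefix_length_le h2 (prefix_append _ _) (by simp; omega)
    rw [prefix_iff_eq_take] at ht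
    have hba := hab.symm
    -- Only prefixes of the initial block of length below 9 remain, and they are tested one by one.
    generalize t.length = n at hl ht
    interval_cases n <;> simp at ht <;> subst ht <;>
      simp [tripleL, tripleR, hab, hba] at h ⊢
  · rintro (rfl | rfl | rfl) <;> simp [tripleL, tripleR]

end ExactlyThree

/-! ### Morphisms as values of the variable -/

section Morphisms

variable {Γ : Type u}

/-- A side of an equation in one variable. -/
def side (W : FreeMonoid (Unit ⊕ Γ)) : List (Option Γ) :=
  W.toList.map (Sum.elim (fun _ => none) some)

/-- The equation with the given sides. -/
def ofSides (U V : List (Option Γ)) : WordEquation Unit Γ :=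
  ⟨FreeMonoid.ofList (U.map fun o => o.elim (Sum.inl ()) Sum.inr),
    FreeMonoid.ofList (V.map fun o => o.elim (Sum.inl ()) Sum.inr)⟩

lemma side_ofList (U : List (Option Γ)) :
    side (FreeMonoid.ofList (U.map fun o => o.elim (Sum.inl ()) Sum.inr)) = U := by
  simp only [side, FreeMonoid.toList_ofList]
  induction U using side_induction <;> simp_all

/-- The value of the variable under a morphism. -/
def value (h : FreeMonoid (Unit ⊕ Γ) →* FreeMonoid Γ) : List Γ :=
  (h (FreeMonoid.of (Sum.inl ()))).toList

lemma toList_apply {h : FreeMonoid (Unit ⊕ Γ) →* FreeMonoid Γ}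
    (hc : ∀ c : Γ, h (FreeMonoid.of (Sum.inr c)) = FreeMonoid.of c) (W : FreeMonoid (Unit ⊕ Γ)) :
    (h W).toList = sub (value h) (side W) := by
  induction W using FreeMonoid.recOn with
  | one => simp [side]
  | of_mul s W ih =>
    rw [map_mul, FreeMonoid.toList_mul, ih]
    cases s with
    | inl s => simp [side, value]
    | inr c => simp [side, hc]

lemma value_injOn (E : WordEquation Unit Γ) : Set.InjOn value E.sol := by
  intro h hh g hg he
  ext W
  apply FreeMonoid.toList.injective
  rw [toList_apply hh.1, toList_apply hg.1, he]

lemma value_image (E : WordEquation Unit Γ) :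
    value '' E.sol = {t | sub t (side E.lhs) = sub t (side E.rhs)} := by
  ext t
  constructor
  · rintro ⟨h, hh, rfl⟩
    have := congrArg FreeMonoid.toList hh.2
    rwa [toList_apply hh.1, toList_apply hh.1] at this
  · intro ht
    set h : FreeMonoid (Unit ⊕ Γ) →* FreeMonoid Γ :=
      FreeMonoid.lift (Sum.elim (fun _ => FreeMonoid.ofList t) FreeMonoid.of) with hh
    have hv : value h = t := by simp [value, hh]
    have hc : ∀ c : Γ, h (FreeMonoid.of (Sum.inr c)) = FreeMonoid.of c := fun c => by simp [hh]
    refine ⟨h, ⟨hc, ?_⟩, hv⟩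
    apply FreeMonoid.toList.injective
    rw [toList_apply hc, toList_apply hc, hv]
    exact ht

end Morphisms

end OneVar

/-- A word equation with constants in one variable (the single element of `Unit`) that has only
finitely many solutions has at most three; and over every alphabet with at least two letters, some
equation has exactly three solutions. -/
theorem mainTheorem1 {Γ : Type*} :
    (∀ E : WordEquation Unit Γ, E.sol.Finite → E.sol.encard ≤ 3) ∧
      (Nontrivial Γ → ∃ E : WordEquation Unit Γ, E.sol.encard = 3) := by
  refine ⟨fun E hE => ?_, fun hΓ => ?_⟩
  · rw [← (OneVar.value_injOn E).encard_image, OneVar.value_image]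
    apply OneVar.encard_solutions_le
    rw [← OneVar.value_image]
    exact hE.image _
  · obtain ⟨a, b, hab⟩ := exists_pair_ne Γ
    refine ⟨OneVar.ofSides (OneVar.tripleL a b) (OneVar.tripleR a b), ?_⟩
    rw [← (OneVar.value_injOn _).encard_image, OneVar.value_image]
    simp only [OneVar.ofSides, OneVar.side_ofList]
    rw [OneVar.triple_solutions hab, Set.encard_eq_three]
    exact ⟨_, _, _, by simp, by simp, by simp, rfl⟩
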